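/- Let $(\mathcal Y,\mathcal F)$ be a measurable space, $\mathcal P(\mathcal Y)$ the set of probability measures on it, $\mathcal W\subset\mathcal P(\mathcal Y)$, and $\mathcal P(\mathcal W)$ the set of probability mass functions with finite support in $\mathcal W$ (the priors). Let $\alpha\in(0,\infty]$. Rényi divergence: for finite nonzero measures $W,Q$ and a reference measure $\nu$ with $W,Q\ll\nu$, put $w=\frac{dW}{d\nu}$, $q=\frac{dQ}{d\nu}$ and let $D_\alpha(W\|Q)$ be $\frac1{\alpha-1}\ln\int w^{\alpha}q^{1-\alpha}\,d\nu$ if $\alpha\ne1,\infty$, $\int w(\ln w-\ln q)\,d\nu$ if $\alpha=1$, and $\ln\operatorname{ess\,sup}_\nu\frac{w}{q}$ if $\alpha=\infty$. Mean measure, information, mean: for $P\in\mathcal P(\mathcal W)$ let $\mu_{\alpha,P}$ be the measure with density $\bigl(\sum_W P(W)(\frac{dW}{d\nu})^{\alpha}\bigr)^{1/\alpha}$ for $\alpha<\infty$, and $\max_{W:P(W)>0}\frac{dW}{d\nu}$ for $\alpha=\infty$, with respect to any reference measure $\nu$ for the support of $P$. The Rényi information $I_\alpha(P;\mathcal W)$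 is $\frac{\alpha}{\alpha-1}\ln\mu_{\alpha,P}(\mathcal Y)$ if $\alpha\neq1,\infty$, $\ln\mu_{\infty,P}(\mathcal Y)$ if $\alpha=\infty$, and $\int\sum_W\pi(W|y)\ln\frac{\pi(W|y)}{P(W)}\,\mu_{1,P}(dy)$ with $\pi(W|y)=P(W)\frac{dW}{d\mu_{1,P}}(y)$ if $\alpha=1$. The Rényi mean is $q_{\alpha,P}=\mu_{\alpha,P}/\mu_{\alpha,P}(\mathcal Y)$. Let $P\circledast\mathcal W$ be the probability measure on $\operatorname{supp}P\times\mathcal Y$ with marginal $P$ on $\operatorname{supp}P$ and conditional distribution $W$ given $W\in\operatorname{supp}P$. Let $\mathcal A\subset\mathcal P(\mathcal W)$ be nonempty and convex, and put $C_{\alpha,\mathcal W,\mathcal A}=\sup_{P\in\mathcal A}I_\alpha(P;\mathcal W)\in[0,\infty]$. Then $$C_{\alpha,\mathcal W,\mathcal A}=\sup_{P\in\mathcal A}\inf_{Q\in\mathcal P(\mathcal Y)}D_\alpha(P\circledast\mathcal W\|P\otimes Q)=\inf_{Q\in\mathcal P(\mathcal Y)}\sup_{P\in\mathcal A}D_\alpha(P\circledast\mathcal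 W\|P\otimes Q).$$ If $C_{\alpha,\mathcal W,\mathcal A}<\infty$, then there is a unique $q_{\alpha,\mathcal W,\mathcal A}\in\mathcal P(\mathcal Y)$ (the constrained center) with $$C_{\alpha,\mathcal W,\mathcal A}=\sup_{P\in\mathcal A}D_\alpha(P\circledast\mathcal W\|P\otimes q_{\alpha,\mathcal W,\mathcal A}).$$ Moreover, for every sequence $(P_n)$ in $\mathcal A$ with $I_\alpha(P_n;\mathcal W)\to C_{\alpha,\mathcal W,\mathcal A}$, the sequence of Rényi means $(q_{\alpha,P_n})$ is Cauchy in total variation and $q_{\alpha,\mathcal W,\mathcal A}$ is its unique limit; and for every $Q\in\mathcal P(\mathcal Y)$ (the constrained van Erven–Harremoës bound) $$C_{\alpha,\mathcal W,\mathcal A}+D_\alpha(q_{\alpha,\mathcal W,\mathcal A}\|Q)\le\sup_{P\in\mathcal A}D_\alpha(P\circledast\mathcal W\|P\otimes Q).$$ -/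

import Mathlib

open MeasureTheory ProbabilityTheory Filter Topology
open scoped ENNReal

noncomputable section

namespace Renyi

variable {Y : Type*} [MeasurableSpace Y]

/-- The order `α` Rényi divergence `D_α(W‖Q)` of finite nonzero measures, for `α ∈ [0,∞]`, with
reference measure `W + Q`. For `α = 1` it is `∫ w (ln w - ln q) dν`: Mathlib's `klDiv` is this
integral plus the correction `Q(Y) - W(Y)`, which is subtracted again (it vanishes for
probability measures). In `w ^ a * q ^ (1 - a)` and `w / q` a point with `w > 0 = q` gives `∞`
when `a > 1`. -/
def divergence {Z : Type*} [MeasurableSpace Z] (α : ℝ≥0∞) (W Q : Measure Z) : EReal :=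
  if α = 0 then -ENNReal.log (Q {z | 0 < W.rnDeriv (W + Q) z})
  else if α = 1 then
    (InformationTheory.klDiv W Q : EReal) + (W Set.univ : EReal) - (Q Set.univ : EReal)
  else if α = ∞ then
    ENNReal.log (essSup (fun z => W.rnDeriv (W + Q) z / Q.rnDeriv (W + Q) z) (W + Q))
  else
    (((α.toReal - 1)⁻¹ : ℝ) : EReal) *
      ENNReal.log (∫⁻ z, W.rnDeriv (W + Q) z ^ α.toReal * Q.rnDeriv (W + Q) z ^ (1 - α.toReal)
        ∂(W + Q))

/-- `𝒫(𝒲)`: the probability mass functions with finite support contained in `𝒲`, as a subset of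
the real vector space of finitely supported functions on the probability measures on `Y`. -/
def priors (𝒲 : Set (ProbabilityMeasure Y)) : Set (ProbabilityMeasure Y →₀ ℝ) :=
  {P | (∀ w, 0 ≤ P w) ∧ (↑P.support : Set (ProbabilityMeasure Y)) ⊆ 𝒲 ∧
    ∑ w ∈ P.support, P w = 1}

/-- The finite support of a prior, to be equipped with the σ-algebra of all its subsets. -/
def Support (P : ProbabilityMeasure Y →₀ ℝ) : Type _ := {w : ProbabilityMeasure Y // w ∈ P.support}

instance (P : ProbabilityMeasure Y →₀ ℝ) : MeasurableSpace (Support P) := ⊤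

instance (P : ProbabilityMeasure Y →₀ ℝ) : DiscreteMeasurableSpace (Support P) :=
  ⟨fun _ => trivial⟩

instance (P : ProbabilityMeasure Y →₀ ℝ) : Fintype (Support P) :=
  inferInstanceAs (Fintype {w // w ∈ P.support})

/-- The prior `P` as a measure on its support. -/
def priorMeasure (P : ProbabilityMeasure Y →₀ ℝ) : Measure (Support P) :=
  ∑ w : Support P, ENNReal.ofReal (P w.1) • Measure.dirac w

/-- The Markov kernel from the support of `P` to `Y` that sends `W` to `W` itself. -/
def channel (P : ProbabilityMeasure Y →₀ ℝ) : Kernel (Support P) Y where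
  toFun w := (w.1 : Measure Y)
  measurable' := .of_discrete

instance (P : ProbabilityMeasure Y →₀ ℝ) : IsMarkovKernel (channel P) :=
  ⟨fun w => inferInstanceAs (IsProbabilityMeasure (w.1 : Measure Y))⟩

instance (P : ProbabilityMeasure Y →₀ ℝ) : IsFiniteMeasure (priorMeasure P) :=
  ⟨by simp [priorMeasure, ENNReal.sum_lt_top]⟩

/-- `P ⊛ 𝒲`: the measure on `supp P × Y` whose marginal on `supp P` is `P` and whose conditional
distribution given `W ∈ supp P` is `W`. -/
def joint (P : ProbabilityMeasure Y →₀ ℝ) : Measure (Support P × Y) :=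
  priorMeasure P ⊗ₘ channel P

/-- `D_α(P ⊛ 𝒲 ‖ P ⊗ Q)`. -/
def jointDivergence (α : ℝ≥0∞) (P : ProbabilityMeasure Y →₀ ℝ) (Q : ProbabilityMeasure Y) :
    EReal :=
  divergence α (joint P) ((priorMeasure P).prod (Q : Measure Y))

/-- The mixture `μ_{1,P} = ∑ P(W) W`, a reference measure for the support of `P`. -/
def mixture (P : ProbabilityMeasure Y →₀ ℝ) : Measure Y :=
  ∑ w ∈ P.support, ENNReal.ofReal (P w) • (w : Measure Y)

/-- The density of the order `α` mean measure with respect to `mixture P`: the pointwise order `α`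
weighted power mean of the densities of the members of the support. -/
def meanDensity (α : ℝ≥0∞) (P : ProbabilityMeasure Y →₀ ℝ) (y : Y) : ℝ≥0∞ :=
  if α = 0 then ∏ w ∈ P.support, ((w : Measure Y).rnDeriv (mixture P) y) ^ (P w)
  else if α = ∞ then ⨆ w ∈ P.support, (w : Measure Y).rnDeriv (mixture P) y
  else (∑ w ∈ P.support, ENNReal.ofReal (P w) *
    ((w : Measure Y).rnDeriv (mixture P) y) ^ α.toReal) ^ (α.toReal)⁻¹

/-- The order `α` mean measure `μ_{α,P}`. -/
def meanMeasure (α : ℝ≥0∞) (P : ProbabilityMeasure Y →₀ ℝ) : Measure Y :=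
  (mixture P).withDensity (meanDensity α P)

/-- The order `α` Rényi mean `q_{α,P} = μ_{α,P} / ‖μ_{α,P}‖`, for `α ∈ (0,∞]`. -/
def renyiMean (α : ℝ≥0∞) (P : ProbabilityMeasure Y →₀ ℝ) : Measure Y :=
  (meanMeasure α P Set.univ)⁻¹ • meanMeasure α P

/-- The order one posterior `π₁(W|y) = P(W) dW/dμ_{1,P}(y)`. -/
def posteriorPMF (P : ProbabilityMeasure Y →₀ ℝ) (w : ProbabilityMeasure Y) (y : Y) : ℝ :=
  P w * ((w : Measure Y).rnDeriv (mixture P) y).toReal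

open scoped Classical in
/-- The order `α` Rényi information `I_α(P;𝒲)` for the prior `P`, in closed form. It depends on
`𝒲` only through the requirement that `P` be a prior on `𝒲`. -/
def information (α : ℝ≥0∞) (P : ProbabilityMeasure Y →₀ ℝ) : EReal :=
  if α = 0 then
    essInf (fun y => ENNReal.log
      (∑ w ∈ P.support, if 0 < posteriorPMF P w y then ENNReal.ofReal (P w) else 0)⁻¹) (mixture P)
  else if α = 1 then
    ((∫ y, ∑ w ∈ P.support, posteriorPMF P w y * Real.log (posteriorPMF P w y / P w) ∂(mixture P) : ℝ) :
      EReal)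
  else if α = ∞ then ENNReal.log (meanMeasure ∞ P Set.univ)
  else ((α.toReal / (α.toReal - 1) : ℝ) : EReal) * ENNReal.log (meanMeasure α P Set.univ)

/-- The order `α` Rényi capacity `C_{α,𝒲,𝒜}` for the constraint set `𝒜 ⊆ 𝒫(𝒲)`. -/
def capacity (α : ℝ≥0∞) (𝒜 : Set (ProbabilityMeasure Y →₀ ℝ)) : EReal :=
  ⨆ P ∈ 𝒜, information α P

/-- `q` is an order `α` Rényi center for the constraint set `𝒜`. -/
def IsCenter (α : ℝ≥0∞) (𝒜 : Set (ProbabilityMeasure Y →₀ ℝ)) (q : ProbabilityMeasure Y) : Prop :=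
  capacity α 𝒜 = ⨆ P ∈ 𝒜, jointDivergence α P q

/-- The total variation distance `‖μ - ν‖ = sup_E (μ - ν)(E) - (μ - ν)(Eᶜ)` of finite measures. -/
def tvDist (μ ν : Measure Y) : ℝ :=
  ⨆ E : {E : Set Y // MeasurableSet E},
    ((μ.real E.1 - ν.real E.1) - (μ.real E.1ᶜ - ν.real E.1ᶜ))

end Renyi

end

/-! The proof rests on Sibson's identity `jointDivergence_eq`: D_α(P ⊛ 𝒲 ‖ P ⊗ Q) = I_α(P) +
D_α(q_{α,P} ‖ Q). Since divergences of probability measures are nonnegative and vanish on the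
diagonal, the infimum over Q is I_α(P), attained at the Rényi mean. This gives the max-min formula
and the easy half of the min-max formula. What remains is to find, for finite capacity C, one q with
all joint divergences at most C.

All finite orders are treated together. D_α is a strictly increasing function of an f-divergence
`fdiv` whose generator is convex, nonnegative and zero only at 1 (`divergence_le_iff`); order ∞ is
read through the inequality W ≤ e^c Q (`divergence_top_le_iff`). Two facts about D_α follow: a small
divergence forces a small total variation distance, and D_α is jointly lower semicontinuous for
total variation. Moreover `fdiv` of the joint measure is affine in the prior (`fdiv_joint`), which
D_α in general is not.

The convexity of 𝒜 enters only in `exists_mixture_jointDivergence_le`. Let P' be almost optimal, P ∈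
𝒜 arbitrary, and R the Rényi mean of (1-t)P' + tP. The average of the two joint f-divergences
relative to R corresponds to a value at most C, while the one of P' cannot be much smaller because
I_α(P') is nearly C. So the one of P cannot be much larger either, and both priors have joint
divergence at most C + ε relative to R. For order ∞ the joint divergence depends only on the support
of the prior, and the midpoint suffices.

If P and P' are both almost optimal, Sibson's identity makes both Rényi means close to R, so the
means of a maximizing sequence are Cauchy and have a limit q. For fixed P, letting P' run through
the sequence gives measures R → q with joint divergence tending to at most C, and lower
semicontinuity gives the bound at q. Conversely, a center q satisfies D_α(q_{α,P_n} ‖ q) ≤ C -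
I_α(P_n) → 0, so it is the limit of the means of every maximizing sequence and hence unique. The van
Erven–Harremoës bound is Sibson's identity along a maximizing sequence, passed to the limit by lower
semicontinuity. -/

namespace Renyi

/-! ### Total variation distance of probability measures and its completeness. -/

section TotalVariation

variable {Y : Type*} [MeasurableSpace Y] {μ ν : Measure Y}
  [IsProbabilityMeasure μ] [IsProbabilityMeasure ν]

/-- Both measures have mass one, so the complementary term repeats the first. This is the source of
the factors 1/2 in the bounds on single events. -/
lemma tvDist_eq_iSup (μ ν : Measure Y) [IsProbabilityMeasure μ] [IsProbabilityMeasure ν] :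
    tvDist μ ν = ⨆ E : {E : Set Y // MeasurableSet E}, 2 * (μ.real E.1 - ν.real E.1) := by
  unfold tvDist
  congr 1
  ext E
  rw [probReal_compl_eq_one_sub E.2, probReal_compl_eq_one_sub E.2]
  ring

lemma tvDist_le {ε : ℝ} (h : ∀ E, MeasurableSet E → μ.real E - ν.real E ≤ ε / 2) :
    tvDist μ ν ≤ ε := by
  rw [tvDist_eq_iSup]
  have : Nonempty {E : Set Y // MeasurableSet E} := ⟨⟨∅, MeasurableSet.empty⟩⟩
  exact ciSup_le fun E => by linarith [h E.1 E.2]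

lemma real_sub_le_tvDist {E : Set Y} (hE : MeasurableSet E) :
    μ.real E - ν.real E ≤ tvDist μ ν / 2 := by
  rw [tvDist_eq_iSup]
  have hb : BddAbove (Set.range fun E : {E : Set Y // MeasurableSet E} =>
      2 * (μ.real E.1 - ν.real E.1)) := by
    refine ⟨2, ?_⟩
    rintro _ ⟨F, rfl⟩
    have h1 : μ.real F.1 ≤ 1 := measureReal_le_one
    have h2 : 0 ≤ ν.real F.1 := measureReal_nonneg
    dsimp only
    linarith
  linarith [le_ciSup hb ⟨E, hE⟩]

@[simp] lemma tvDist_self (μ : Measure Y) : tvDist μ μ = 0 := by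
  simp [tvDist]

lemma tvDist_nonneg : 0 ≤ tvDist μ ν := by
  have := real_sub_le_tvDist (μ := μ) (ν := ν) MeasurableSet.empty
  simp at this
  linarith

lemma tvDist_comm (μ ν : Measure Y) [IsProbabilityMeasure μ] [IsProbabilityMeasure ν] :
    tvDist μ ν = tvDist ν μ := by
  have key : ∀ (μ ν : Measure Y) [IsProbabilityMeasure μ] [IsProbabilityMeasure ν],
      tvDist μ ν ≤ tvDist ν μ := by
    intro μ ν _ _
    refine tvDist_le fun E hE => ?_
    have := real_sub_le_tvDist (μ := ν) (ν := μ) hE.compl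
    rw [probReal_compl_eq_one_sub hE, probReal_compl_eq_one_sub hE] at this
    linarith
  exact le_antisymm (key μ ν) (key ν μ)

lemma abs_real_sub_le_tvDist {E : Set Y} (hE : MeasurableSet E) :
    |μ.real E - ν.real E| ≤ tvDist μ ν / 2 := by
  rw [abs_le]
  have h := real_sub_le_tvDist (μ := ν) (ν := μ) hE
  rw [tvDist_comm ν μ] at h
  exact ⟨by linarith, real_sub_le_tvDist hE⟩

lemma tvDist_triangle (μ ν ρ : Measure Y) [IsProbabilityMeasure μ] [IsProbabilityMeasure ν]
    [IsProbabilityMeasure ρ] : tvDist μ ρ ≤ tvDist μ ν + tvDist ν ρ := by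
  refine tvDist_le fun E hE => ?_
  have h1 := real_sub_le_tvDist (μ := μ) (ν := ν) hE
  have h2 := real_sub_le_tvDist (μ := ν) (ν := ρ) hE
  linarith

lemma eq_of_tvDist_le_zero (h : tvDist μ ν ≤ 0) : μ = ν := by
  refine Measure.ext fun E hE => ?_
  have h1 := abs_real_sub_le_tvDist (μ := μ) (ν := ν) hE
  have h2 : μ.real E = ν.real E := by
    have : |μ.real E - ν.real E| ≤ 0 := by linarith
    linarith [abs_nonpos_iff.1 this]
  exact (measureReal_eq_measureReal_iff).1 h2

lemma eq_of_tendsto_tvDist {P : ℕ → Measure Y} [∀ n, IsProbabilityMeasure (P n)]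
    (hμ : Tendsto (fun n => tvDist (P n) μ) atTop (𝓝 0))
    (hν : Tendsto (fun n => tvDist (P n) ν) atTop (𝓝 0)) : μ = ν := by
  refine eq_of_tvDist_le_zero ?_
  refine ge_of_tendsto (by simpa using hμ.add hν) (.of_forall fun n => ?_)
  rw [tvDist_comm (P n) μ]
  exact tvDist_triangle _ _ _

/-- Completeness of the set of probability measures in total variation. -/
lemma exists_tendsto_tvDist_of_cauchy (P : ℕ → Measure Y) [∀ n, IsProbabilityMeasure (P n)]
    (hP : ∀ ε : ℝ, 0 < ε → ∃ N : ℕ, ∀ m ≥ N, ∀ n ≥ N, tvDist (P m) (P n) < ε) :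
    ∃ q : ProbabilityMeasure Y, Tendsto (fun n => tvDist (P n) (q : Measure Y)) atTop (𝓝 0) := by
  have hlim : ∀ E : {E : Set Y // MeasurableSet E}, ∃ l, Tendsto (fun n => (P n).real E.1)
      atTop (𝓝 l) := by
    intro E
    refine cauchySeq_tendsto_of_complete (Metric.cauchySeq_iff.2 fun ε hε => ?_)
    obtain ⟨N, hN⟩ := hP ε hε
    refine ⟨N, fun m hm n hn => ?_⟩
    rw [Real.dist_eq]
    have h1 := abs_real_sub_le_tvDist (μ := P m) (ν := P n) E.2
    have h0 := tvDist_nonneg (μ := P m) (ν := P n)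
    linarith [hN m hm n hn]
  choose l hl using hlim
  have hl0 : ∀ E, 0 ≤ l E := fun E => ge_of_tendsto' (hl E) fun n => measureReal_nonneg
  -- Letting m → ∞ in the Cauchy bound makes the setwise convergence uniform over all events;
  -- countable additivity of the limit needs this.
  have hunif : ∀ ε : ℝ, 0 < ε → ∃ N : ℕ, ∀ n ≥ N, ∀ E : {E : Set Y // MeasurableSet E},
      |(P n).real E.1 - l E| ≤ ε := by
    intro ε hε
    obtain ⟨N, hN⟩ := hP ε hε
    refine ⟨N, fun n hn E => ?_⟩
    refine le_of_tendsto ((tendsto_const_nhds.sub (hl E)).abs) ?_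
    filter_upwards [eventually_ge_atTop N] with m hm
    have h1 := abs_real_sub_le_tvDist (μ := P n) (ν := P m) E.2
    have h0 := tvDist_nonneg (μ := P n) (ν := P m)
    linarith [hN n hn m hm]
  -- Finite additivity passes to setwise limits. For countable unions, `l` is replaced by one P N,
  -- uniformly close to it, on both the finite and the full union.
  have hadd : ∀ (f : ℕ → Set Y) (hf : ∀ i, MeasurableSet (f i)),
      Pairwise (Function.onFun Disjoint f) →
      HasSum (fun i => l ⟨f i, hf i⟩) (l ⟨⋃ i, f i, .iUnion hf⟩) := by
    intro f hf hd
    have hfin : ∀ s : Finset ℕ, ∑ i ∈ s, l ⟨f i, hf i⟩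
        = l ⟨⋃ i ∈ s, f i, s.measurableSet_biUnion fun i _ => hf i⟩ := by
      intro s
      refine tendsto_nhds_unique (tendsto_finsetSum s fun i _ => hl ⟨f i, hf i⟩) ?_
      refine (hl ⟨⋃ i ∈ s, f i, s.measurableSet_biUnion fun i _ => hf i⟩).congr fun n => ?_
      exact measureReal_biUnion_finset (fun i _ j _ hij => hd hij) fun i _ => hf i
    rw [HasSum, Metric.tendsto_nhds]
    intro ε hε
    obtain ⟨N, hN⟩ := hunif (ε / 4) (by positivity)
    have hs : HasSum (fun i => (P N).real (f i)) ((P N).real (⋃ i, f i)) := by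
      have h := ENNReal.hasSum_toReal (f := fun i => P N (f i))
        (by rw [← measure_iUnion hd hf]; exact measure_ne_top _ _)
      rwa [← ENNReal.tsum_toReal_eq fun i => measure_ne_top _ _, ← measure_iUnion hd hf] at h
    have := Metric.tendsto_nhds.1 hs (ε / 4) (by positivity)
    filter_upwards [this] with s hs
    rw [Real.dist_eq] at hs ⊢
    rw [hfin s]
    have h1 := hN N le_rfl ⟨⋃ i ∈ s, f i, s.measurableSet_biUnion fun i _ => hf i⟩
    have h2 := hN N le_rfl ⟨⋃ i, f i, .iUnion hf⟩
    have h3 : (P N).real (⋃ i ∈ s, f i) = ∑ i ∈ s, (P N).real (f i) :=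
      measureReal_biUnion_finset (fun i _ j _ hij => hd hij) fun i _ => hf i
    simp only at h1 h2
    rw [← h3, abs_lt] at hs
    rw [abs_le] at h1 h2
    rw [abs_lt]
    constructor <;> linarith [h1.1, h1.2, h2.1, h2.2, hs.1, hs.2]
  let q : Measure Y := Measure.ofMeasurable (fun E hE => ENNReal.ofReal (l ⟨E, hE⟩))
    (by
      have : l ⟨∅, MeasurableSet.empty⟩ = 0 :=
        tendsto_nhds_unique (hl _) (by simp)
      simp only [this, ENNReal.ofReal_zero])
    (by
      intro f hf hd
      have h := hadd f hf hd
      rw [← h.tsum_eq, ENNReal.ofReal_tsum_of_nonneg (fun i => hl0 _) h.summable])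
  have hq : ∀ E (hE : MeasurableSet E), q E = ENNReal.ofReal (l ⟨E, hE⟩) := fun E hE =>
    Measure.ofMeasurable_apply E hE
  have hqp : IsProbabilityMeasure q := by
    refine ⟨?_⟩
    have : l ⟨Set.univ, MeasurableSet.univ⟩ = 1 :=
      tendsto_nhds_unique (hl _) (by simp)
    rw [hq _ MeasurableSet.univ, this, ENNReal.ofReal_one]
  refine ⟨⟨q, hqp⟩, ?_⟩
  rw [Metric.tendsto_atTop]
  intro ε hε
  obtain ⟨N, hN⟩ := hunif (ε / 4) (by positivity)
  refine ⟨N, fun n hn => ?_⟩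
  change dist (tvDist (P n) q) 0 < ε
  rw [Real.dist_eq, sub_zero, abs_of_nonneg tvDist_nonneg]
  refine (tvDist_le (ε := ε / 2) fun E hE => ?_).trans_lt (by linarith)
  have h1 := hN n hn ⟨E, hE⟩
  have h2 : q.real E = l ⟨E, hE⟩ := by
    rw [Measure.real, hq E hE, ENNReal.toReal_ofReal (hl0 _)]
  rw [h2]
  linarith [(abs_le.1 h1).2]

end TotalVariation

end Renyi

namespace Renyi

/-! ### The convex generator and its perspective function. -/

section Generator

/-- The generator of the order `a` divergence: the convex function
`(t ^ a - a t + a - 1) / (a - 1)`, with minimum `0` at `t = 1`, and `t ln t + 1 - t` for `a = 1`. -/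
noncomputable def gen (a t : ℝ) : ℝ :=
  if a = 1 then InformationTheory.klFun t else (t ^ a - a * t + a - 1) / (a - 1)

/-- The slope at infinity of the generator. -/
noncomputable def genSlope (a : ℝ) : ℝ≥0∞ := if a < 1 then ENNReal.ofReal (a / (1 - a)) else ∞

/-- The perspective `q · gen (w / q)` of the generator. -/
noncomputable def persp (a : ℝ) (w q : ℝ≥0∞) : ℝ≥0∞ :=
  if q = 0 then genSlope a * w else q * ENNReal.ofReal (gen a (w / q).toReal)

variable {a : ℝ}

lemma gen_eq_klFun : gen 1 = InformationTheory.klFun := by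
  ext t; simp [gen]

lemma gen_of_ne_one (h : a ≠ 1) : gen a = fun t => (t ^ a - a * t + a - 1) / (a - 1) := by
  ext t; simp [gen, h]

lemma continuous_gen (ha : 0 < a) : Continuous (gen a) := by
  by_cases h : a = 1
  · simpa [h, gen_eq_klFun] using InformationTheory.continuous_klFun
  · rw [gen_of_ne_one h]
    have := Real.continuous_rpow_const ha.le
    fun_prop

@[simp] lemma gen_one (a : ℝ) : gen a 1 = 0 := by
  simp [gen, InformationTheory.klFun_one]

/-- Strict Bernoulli inequality, in the direction fixed by the sign of a - 1. -/
lemma gen_pos (ha : 0 < a) {t : ℝ} (ht : 0 ≤ t) (h1 : t ≠ 1) : 0 < gen a t := by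
  unfold gen
  split_ifs with h
  · exact lt_of_le_of_ne (InformationTheory.klFun_nonneg ht)
      fun h => h1 ((InformationTheory.klFun_eq_zero_iff ht).1 h.symm)
  · rcases lt_or_gt_of_ne h with h | h
    · have := rpow_one_add_lt_one_add_mul_self (s := t - 1) (by linarith) (sub_ne_zero.2 h1) ha h
      rw [add_sub_cancel] at this
      exact div_pos_of_neg_of_neg (by linarith) (by linarith)
    · have := one_add_mul_self_lt_rpow_one_add (s := t - 1) (by linarith) (sub_ne_zero.2 h1) h
      rw [add_sub_cancel] at this
      exact div_pos (by linarith) (by linarith)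

lemma gen_nonneg (ha : 0 < a) {t : ℝ} (ht : 0 ≤ t) : 0 ≤ gen a t := by
  by_cases h : t = 1
  · simp [h]
  · exact (gen_pos ha ht h).le

lemma convexOn_gen (ha : 0 < a) : ConvexOn ℝ (Set.Ici 0) (gen a) := by
  rcases lt_trichotomy a 1 with h | h | h
  · have h1 := (Real.concaveOn_rpow ha.le h.le).neg
    have h2 : ConvexOn ℝ (Set.Ici 0) fun t : ℝ => (1 - a)⁻¹ * (-t ^ a) :=
      h1.smul (c := (1 - a)⁻¹) (inv_nonneg.2 (by linarith))
    have h3 : ConvexOn ℝ (Set.Ici (0 : ℝ)) fun t : ℝ => (a / (1 - a)) * t :=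
      (convexOn_id (convex_Ici 0)).smul (c := a / (1 - a)) (div_nonneg ha.le (by linarith))
    refine ((h2.add h3).add_const 1).congr fun t _ => ?_
    simp only [gen, h.ne, if_false, Pi.add_apply]
    have : a - 1 ≠ 0 := by linarith
    have : 1 - a ≠ 0 := by linarith
    field_simp
    ring
  · subst h
    simpa [gen_eq_klFun] using InformationTheory.convexOn_klFun
  · have h2 : ConvexOn ℝ (Set.Ici 0) fun t : ℝ => (a - 1)⁻¹ * (t ^ a) :=
      (convexOn_rpow h.le).smul (c := (a - 1)⁻¹) (inv_nonneg.2 (by linarith))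
    have h3 : ConvexOn ℝ (Set.Ici (0 : ℝ)) fun t : ℝ => (a / (a - 1)) * (-t) :=
      ((concaveOn_id (convex_Ici 0)).neg).smul (c := a / (a - 1))
        (div_nonneg ha.le (by linarith))
    refine ((h2.add h3).add_const 1).congr fun t _ => ?_
    simp only [gen, h.ne', if_false, Pi.add_apply]
    have : a - 1 ≠ 0 := by linarith
    field_simp
    ring

/-- For t > 1 + ε the point 1 + ε lies between 1, where the generator vanishes, and t; convexity
bounds t - 1 by a multiple of the generator at t. This is the pointwise source of the control of
total variation. -/
lemma exists_le_add_mul_gen (ha : 0 < a) {ε : ℝ} (hε : 0 < ε) :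
    ∃ M : ℝ, 0 < M ∧ ∀ t, 0 ≤ t → t ≤ 1 + ε + M * gen a t := by
  have hg : 0 < gen a (1 + ε) := gen_pos ha (by linarith) (by linarith)
  refine ⟨ε / gen a (1 + ε), by positivity, fun t ht => ?_⟩
  have h0 := gen_nonneg ha ht
  rcases le_or_gt t (1 + ε) with h | h
  · have : 0 ≤ ε / gen a (1 + ε) * gen a t := by positivity
    linarith
  · have ht1 : 0 < t - 1 := by linarith
    have hc := (convexOn_gen ha).2 (show (1 : ℝ) ∈ Set.Ici 0 by simp) (show t ∈ Set.Ici 0 from ht)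
      (show 0 ≤ 1 - ε / (t - 1) by rw [sub_nonneg, div_le_one ht1]; linarith)
      (show 0 ≤ ε / (t - 1) by positivity) (by ring)
    have he : (1 - ε / (t - 1)) • (1 : ℝ) + (ε / (t - 1)) • t = 1 + ε := by
      simp only [smul_eq_mul]; field_simp; ring
    rw [he, gen_one, smul_zero, zero_add, smul_eq_mul] at hc
    have : t - 1 ≤ ε / gen a (1 + ε) * gen a t := by
      rw [div_mul_eq_mul_div, le_div_iff₀ hg]
      rw [div_mul_eq_mul_div, le_div_iff₀ ht1] at hc
      linarith
    linarith

lemma eventually_mul_le_gen (ha : 0 < a) {M : ℝ} (hM : ENNReal.ofReal M < genSlope a) :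
    ∀ᶠ t in atTop, M * t ≤ gen a t := by
  rcases lt_trichotomy a 1 with h | h | h
  · have ha1 : 0 < 1 - a := by linarith
    have hM' : M < a / (1 - a) := by
      rw [genSlope, if_pos h] at hM
      exact (ENNReal.ofReal_lt_ofReal_iff (by positivity)).1 hM
    rw [lt_div_iff₀ ha1] at hM'
    have h1 := tendsto_rpow_neg_atTop ha1
    filter_upwards [h1.eventually (eventually_le_nhds (show (0 : ℝ) < a - M * (1 - a) by linarith)),
      eventually_gt_atTop 0] with t ht ht0
    have he : t ^ a = t ^ (-(1 - a)) * t := by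
      rw [← Real.rpow_add_one ht0.ne']; congr 1; ring
    rw [gen, if_neg h.ne, he, ← neg_div_neg_eq, le_div_iff₀ (by linarith)]
    nlinarith [mul_le_mul_of_nonneg_right ht ht0.le]
  · subst h
    filter_upwards [Real.tendsto_log_atTop.eventually_ge_atTop (M + 1), eventually_gt_atTop 0]
      with t ht ht0
    rw [gen, if_pos rfl, InformationTheory.klFun_apply]
    nlinarith [mul_le_mul_of_nonneg_left ht ht0.le]
  · have ha1 : 0 < a - 1 := by linarith
    filter_upwards [(tendsto_rpow_atTop ha1).eventually_ge_atTop (M * (a - 1) + a),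
      eventually_gt_atTop 0] with t ht ht0
    have he : t ^ a = t ^ (a - 1) * t := by
      rw [← Real.rpow_add_one ht0.ne']; congr 1; ring
    rw [gen, if_neg h.ne', he, le_div_iff₀ ha1]
    nlinarith [mul_le_mul_of_nonneg_right ht ht0.le]

/-- An affine minorant for each slope below the slope at infinity. It yields lower semicontinuity of
the perspective at q = 0, where continuity may fail. -/
lemma exists_mul_le_gen_add (ha : 0 < a) {M : ℝ} (hM0 : 0 ≤ M)
    (hM : ENNReal.ofReal M < genSlope a) :
    ∃ b : ℝ, 0 ≤ b ∧ ∀ t, 0 ≤ t → M * t ≤ gen a t + b := by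
  obtain ⟨T, hT⟩ := eventually_atTop.1 (eventually_mul_le_gen ha hM)
  refine ⟨M * |T|, by positivity, fun t ht => ?_⟩
  have h0 := gen_nonneg ha ht
  rcases le_total T t with h | h
  · have := hT t h
    have : 0 ≤ M * |T| := by positivity
    linarith
  · have : M * t ≤ M * |T| := mul_le_mul_of_nonneg_left (h.trans (le_abs_self T)) hM0
    linarith

lemma measurable_gen (a : ℝ) : Measurable (gen a) := by
  by_cases h : a = 1
  · simpa [h, gen_eq_klFun] using InformationTheory.measurable_klFun
  · rw [gen_of_ne_one h]
    fun_prop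

lemma measurable_persp (a : ℝ) : Measurable (Function.uncurry (persp a)) := by
  unfold persp Function.uncurry
  refine Measurable.ite (measurable_snd (measurableSet_singleton 0)) (by fun_prop) ?_
  exact measurable_snd.mul ((measurable_gen a).comp
    (measurable_fst.div measurable_snd).ennreal_toReal).ennreal_ofReal

/-- Homogeneity is what makes the resulting divergence independent of the reference measure. -/
lemma persp_mul (a : ℝ) {c w q : ℝ≥0∞} (hc : c ≠ ∞) :
    persp a (c * w) (c * q) = c * persp a w q := by
  by_cases h : c = 0
  · simp [h, persp]
  · unfold persp
    simp only [mul_eq_zero, h, false_or, ENNReal.mul_div_mul_left w q h hc]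
    split_ifs <;> ring

@[simp] lemma persp_zero_zero (a : ℝ) : persp a 0 0 = 0 := by simp [persp]

lemma persp_self (a : ℝ) {w : ℝ≥0∞} (hw : w ≠ ∞) : persp a w w = 0 := by
  by_cases h : w = 0
  · simp [h]
  · simp [persp, h, ENNReal.div_self h hw]

lemma exists_le_add_mul_persp (ha : 0 < a) {ε : ℝ} (hε : 0 < ε) :
    ∃ M : ℝ, 0 < M ∧ ∀ w q : ℝ≥0∞, w ≠ ∞ → q ≠ ∞ →
      w ≤ ENNReal.ofReal (1 + ε) * q + ENNReal.ofReal M * persp a w q := by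
  obtain ⟨M, hM, h⟩ := exists_le_add_mul_gen ha hε
  -- The second entry serves q = 0 with a < 1, where the perspective is only a / (1 - a) times w.
  refine ⟨max M ((1 - a) / a), lt_max_of_lt_left hM, fun w q hw hq => ?_⟩
  unfold persp
  split_ifs with hq0
  · subst hq0
    rw [mul_zero, zero_add, ← mul_assoc]
    refine le_mul_of_one_le_left zero_le ?_
    unfold genSlope
    split_ifs with h1
    · have h1' : 0 < 1 - a := by linarith
      rw [← ENNReal.ofReal_mul (by positivity), ← ENNReal.ofReal_one]
      refine ENNReal.ofReal_le_ofReal ?_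
      calc (1 : ℝ) = (1 - a) / a * (a / (1 - a)) := by field_simp
        _ ≤ _ := mul_le_mul_of_nonneg_right (le_max_right _ _) (by positivity)
    · rw [ENNReal.mul_top]
      · exact le_top
      · exact (ENNReal.ofReal_pos.2 (lt_max_of_lt_left hM)).ne'
  · have ht := h (w / q).toReal ENNReal.toReal_nonneg
    have hg := gen_nonneg ha (t := (w / q).toReal) ENNReal.toReal_nonneg
    have ht2 : w / q ≤ ENNReal.ofReal (1 + ε) + ENNReal.ofReal (max M ((1 - a) / a)) *
        ENNReal.ofReal (gen a (w / q).toReal) := by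
      rw [← ENNReal.ofReal_mul (hM.le.trans (le_max_left _ _)), ← ENNReal.ofReal_add (by linarith)
        (mul_nonneg (hM.le.trans (le_max_left _ _)) hg),
        ← ENNReal.ofReal_toReal (ENNReal.div_ne_top hw hq0)]
      refine ENNReal.ofReal_le_ofReal ?_
      rw [ENNReal.ofReal_toReal (ENNReal.div_ne_top hw hq0)]
      have := mul_le_mul_of_nonneg_right (le_max_left M ((1 - a) / a)) hg
      linarith
    calc w = w / q * q := (ENNReal.div_mul_cancel hq0 hq).symm
      _ ≤ _ := mul_le_mul_left ht2 q
      _ = _ := by ring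

lemma mul_le_persp_add (ha : 0 < a) {M b : ℝ} (hM : ENNReal.ofReal M < genSlope a)
    (hM0 : 0 ≤ M) (hb : 0 ≤ b) (h : ∀ t, 0 ≤ t → M * t ≤ gen a t + b) {w q : ℝ≥0∞} (hw : w ≠ ∞)
    (hq : q ≠ ∞) : ENNReal.ofReal M * w ≤ persp a w q + ENNReal.ofReal b * q := by
  unfold persp
  split_ifs with hq0
  · subst hq0
    rw [mul_zero, add_zero]
    gcongr
  · have ht := h (w / q).toReal ENNReal.toReal_nonneg
    have hg := gen_nonneg ha (t := (w / q).toReal) ENNReal.toReal_nonneg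
    have ht2 : ENNReal.ofReal M * (w / q) ≤ ENNReal.ofReal (gen a (w / q).toReal)
        + ENNReal.ofReal b := by
      rw [← ENNReal.ofReal_add hg hb]
      nth_rw 1 [← ENNReal.ofReal_toReal (ENNReal.div_ne_top hw hq0)]
      rw [← ENNReal.ofReal_mul hM0]
      exact ENNReal.ofReal_le_ofReal ht
    calc ENNReal.ofReal M * w = ENNReal.ofReal M * (w / q) * q := by
          rw [mul_assoc, ENNReal.div_mul_cancel hq0 hq]
      _ ≤ _ := mul_le_mul_left ht2 q
      _ = _ := by ring

/-- Lower semicontinuity of the perspective. -/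
lemma persp_le_liminf (ha : 0 < a) {w q : ℕ → ℝ≥0∞} {w' q' : ℝ≥0∞} (hw : Tendsto w atTop (𝓝 w'))
    (hq : Tendsto q atTop (𝓝 q')) (hw' : w' ≠ ∞) (hq' : q' ≠ ∞) :
    persp a w' q' ≤ liminf (fun n => persp a (w n) (q n)) atTop := by
  by_cases h0 : q' = 0
  · subst h0
    rw [persp, if_pos rfl]
    -- The slope at infinity may be ∞, so it is approached by finite M from below; the error term b
    -- q_n of the affine minorant vanishes in the limit.
    refine ENNReal.mul_le_of_forall_lt fun M hM v hv => ?_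
    have hMt : M ≠ ∞ := hM.ne_top
    rw [← ENNReal.ofReal_toReal hMt] at hM
    obtain ⟨b, hb, h⟩ := exists_mul_le_gen_add ha ENNReal.toReal_nonneg hM
    rw [← ENNReal.ofReal_toReal hMt]
    have hlim : Tendsto (fun n => ENNReal.ofReal M.toReal * w n - ENNReal.ofReal b * q n) atTop
        (𝓝 (ENNReal.ofReal M.toReal * w' - ENNReal.ofReal b * 0)) :=
      ENNReal.Tendsto.sub (ENNReal.Tendsto.const_mul hw (Or.inr ENNReal.ofReal_ne_top))
        (ENNReal.Tendsto.const_mul hq (Or.inr ENNReal.ofReal_ne_top)) (Or.inr (by simp))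
    rw [mul_zero, tsub_zero] at hlim
    calc ENNReal.ofReal M.toReal * v ≤ ENNReal.ofReal M.toReal * w' := by gcongr
      _ = liminf (fun n => ENNReal.ofReal M.toReal * w n - ENNReal.ofReal b * q n) atTop :=
          hlim.liminf_eq.symm
      _ ≤ _ := by
        refine liminf_le_liminf ?_
        filter_upwards [hw.eventually (eventually_ne_nhds hw'),
          hq.eventually (eventually_ne_nhds hq')] with n hwn hqn
        rw [tsub_le_iff_right]
        exact mul_le_persp_add ha hM ENNReal.toReal_nonneg hb h hwn hqn
  · have hlim : Tendsto (fun n => persp a (w n) (q n)) atTop (𝓝 (persp a w' q')) := by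
      have h1 : Tendsto (fun n => q n * ENNReal.ofReal (gen a (w n / q n).toReal)) atTop
          (𝓝 (q' * ENNReal.ofReal (gen a (w' / q').toReal))) := by
        refine ENNReal.Tendsto.mul hq (Or.inl h0) ?_ (Or.inr hq')
        refine ENNReal.tendsto_ofReal (((continuous_gen ha).tendsto _).comp ?_)
        exact (ENNReal.tendsto_toReal (ENNReal.div_ne_top hw' h0)).comp
          (ENNReal.Tendsto.div hw (Or.inr h0) hq (Or.inr hw'))
      rw [persp, if_neg h0]
      refine h1.congr' ?_
      filter_upwards [hq.eventually (eventually_ne_nhds h0)] with n hn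
      rw [persp, if_neg hn]
    exact hlim.liminf_eq.ge

end Generator

end Renyi

namespace Renyi

/-! ### The f-divergence: independence of the reference measure and lower semicontinuity. -/

section FDivergence

variable {Z : Type*} [MeasurableSpace Z]

/-- The integral of a homogeneous function of two densities does not depend on the reference
measure. -/
lemma lintegral_rnDeriv_add_eq {Φ : ℝ≥0∞ → ℝ≥0∞ → ℝ≥0∞} (hΦ : Measurable (Function.uncurry Φ))
    (hhom : ∀ c w q, c ≠ ∞ → Φ (c * w) (c * q) = c * Φ w q) {W Q ν : Measure Z}
    [IsFiniteMeasure W] [IsFiniteMeasure Q] [SigmaFinite ν] (hW : W ≪ ν) (hQ : Q ≪ ν) :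
    ∫⁻ z, Φ (W.rnDeriv (W + Q) z) (Q.rnDeriv (W + Q) z) ∂(W + Q)
      = ∫⁻ z, Φ (W.rnDeriv ν z) (Q.rnDeriv ν z) ∂ν := by
  have hm : Measurable fun z => Φ (W.rnDeriv (W + Q) z) (Q.rnDeriv (W + Q) z) :=
    hΦ.comp ((Measure.measurable_rnDeriv _ _).prodMk (Measure.measurable_rnDeriv _ _))
  rw [← lintegral_rnDeriv_mul (Measure.AbsolutelyContinuous.add_left hW hQ) hm.aemeasurable]
  refine lintegral_congr_ae ?_
  have h1 := Measure.rnDeriv_mul_rnDeriv (μ := W) (ν := W + Q) (κ := ν)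
    (Measure.AbsolutelyContinuous.rfl.add_right _)
  have h2 := Measure.rnDeriv_mul_rnDeriv (μ := Q) (ν := W + Q) (κ := ν)
    (Measure.AbsolutelyContinuous.rfl.add_right' _)
  filter_upwards [h1, h2, Measure.rnDeriv_lt_top (W + Q) ν] with z h1 h2 h3
  rw [← hhom _ _ _ h3.ne, ← h1, ← h2, Pi.mul_apply, Pi.mul_apply, mul_comm,
    mul_comm (Q.rnDeriv _ _)]

/-- The `f`-divergence with generator `gen a`. -/
noncomputable def fdiv (a : ℝ) (W Q : Measure Z) : ℝ≥0∞ :=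
  ∫⁻ z, persp a (W.rnDeriv (W + Q) z) (Q.rnDeriv (W + Q) z) ∂(W + Q)

variable {a : ℝ} {W Q : Measure Z} [IsFiniteMeasure W] [IsFiniteMeasure Q]

lemma fdiv_eq_lintegral (a : ℝ) {ν : Measure Z} [SigmaFinite ν] (hW : W ≪ ν) (hQ : Q ≪ ν) :
    fdiv a W Q = ∫⁻ z, persp a (W.rnDeriv ν z) (Q.rnDeriv ν z) ∂ν :=
  lintegral_rnDeriv_add_eq (measurable_persp a) (fun _ _ _ hc => persp_mul a hc) hW hQ

lemma fdiv_self (a : ℝ) (W : Measure Z) [IsFiniteMeasure W] : fdiv a W W = 0 := by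
  rw [fdiv_eq_lintegral a Measure.AbsolutelyContinuous.rfl Measure.AbsolutelyContinuous.rfl]
  refine lintegral_eq_zero_of_ae_eq_zero ?_
  filter_upwards [Measure.rnDeriv_lt_top W W] with z hz
  exact persp_self a hz.ne

/-- The pointwise bound integrated over E. The constant M depends only on a and ε, so a small
divergence controls all events of all pairs of measures at once. -/
lemma exists_measure_le_add_fdiv (ha : 0 < a) {ε : ℝ} (hε : 0 < ε) :
    ∃ M : ℝ, 0 < M ∧ ∀ (W Q : Measure Z) [IsFiniteMeasure W] [IsFiniteMeasure Q] (E : Set Z),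
      MeasurableSet E → W E ≤ ENNReal.ofReal (1 + ε) * Q E + ENNReal.ofReal M * fdiv a W Q := by
  obtain ⟨M, hM, h⟩ := exists_le_add_mul_persp ha hε
  refine ⟨M, hM, fun W Q _ _ E hE => ?_⟩
  have hW : W ≪ W + Q := Measure.AbsolutelyContinuous.rfl.add_right _
  have hQ : Q ≪ W + Q := Measure.AbsolutelyContinuous.rfl.add_right' _
  have hm : Measurable fun z => persp a (W.rnDeriv (W + Q) z) (Q.rnDeriv (W + Q) z) :=
    (measurable_persp a).comp
      ((Measure.measurable_rnDeriv _ _).prodMk (Measure.measurable_rnDeriv _ _))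
  have hmQ := Measure.measurable_rnDeriv Q (W + Q)
  rw [← Measure.setLIntegral_rnDeriv' hW hE, ← Measure.setLIntegral_rnDeriv' hQ hE]
  calc ∫⁻ z in E, W.rnDeriv (W + Q) z ∂(W + Q)
      ≤ ∫⁻ z in E, (ENNReal.ofReal (1 + ε) * Q.rnDeriv (W + Q) z + ENNReal.ofReal M *
          persp a (W.rnDeriv (W + Q) z) (Q.rnDeriv (W + Q) z)) ∂(W + Q) := by
        refine lintegral_mono_ae (ae_restrict_of_ae ?_)
        filter_upwards [Measure.rnDeriv_lt_top W (W + Q), Measure.rnDeriv_lt_top Q (W + Q)]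
          with z h1 h2
        exact h _ _ h1.ne h2.ne
    _ ≤ _ := by
        rw [lintegral_add_left (hmQ.const_mul _), lintegral_const_mul _ hmQ,
          lintegral_const_mul _ hm]
        gcongr
        exact setLIntegral_le_lintegral _ _

/-- Convergence in total variation implies convergence in measure of the densities. -/
lemma tendstoInMeasure_rnDeriv {ν : Measure Z} [IsFiniteMeasure ν] {V : ℕ → Measure Z}
    {V' : Measure Z} [∀ n, IsProbabilityMeasure (V n)] [IsProbabilityMeasure V']
    (hV : ∀ n, V n ≪ ν) (hV' : V' ≪ ν)
    (h : Tendsto (fun n => tvDist (V n) V') atTop (𝓝 0)) :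
    TendstoInMeasure ν (fun n z => ((V n).rnDeriv ν z).toReal) atTop
      (fun z => (V'.rnDeriv ν z).toReal) := by
  rw [tendstoInMeasure_iff_measureReal_dist]
  intro ε hε
  -- One-sided Markov inequality: on the set where the densities differ by at least ε, the
  -- difference of the two measures is at least ε times the ν-measure of the set. The other side
  -- follows by symmetry.
  have key : ∀ (μ ρ : Measure Z) [IsProbabilityMeasure μ] [IsProbabilityMeasure ρ], μ ≪ ν →
      ρ ≪ ν → ν.real {z | ε ≤ (μ.rnDeriv ν z).toReal - (ρ.rnDeriv ν z).toReal}
        ≤ tvDist μ ρ / 2 / ε := by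
    intro μ ρ _ _ hμ hρ
    have hE : MeasurableSet {z | ε ≤ (μ.rnDeriv ν z).toReal - (ρ.rnDeriv ν z).toReal} :=
      measurableSet_le measurable_const ((Measure.measurable_rnDeriv _ _).ennreal_toReal.sub
        (Measure.measurable_rnDeriv _ _).ennreal_toReal)
    rw [le_div_iff₀ hε, mul_comm]
    refine le_trans ?_ (real_sub_le_tvDist hE)
    refine (setIntegral_ge_of_const_le_real hE (measure_ne_top _ _) (fun z hz => hz)
      (Measure.integrable_toReal_rnDeriv.sub Measure.integrable_toReal_rnDeriv).integrableOn).trans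
      (le_of_eq ?_)
    rw [integral_sub Measure.integrable_toReal_rnDeriv.integrableOn
      Measure.integrable_toReal_rnDeriv.integrableOn, Measure.setIntegral_toReal_rnDeriv hμ,
      Measure.setIntegral_toReal_rnDeriv hρ]
  refine squeeze_zero (g := fun n => tvDist (V n) V' / 2 / ε + tvDist (V n) V' / 2 / ε)
    (fun n => measureReal_nonneg) (fun n => ?_) ?_
  · refine (measureReal_mono (s₂ :=
      {z | ε ≤ ((V n).rnDeriv ν z).toReal - (V'.rnDeriv ν z).toReal} ∪
      {z | ε ≤ (V'.rnDeriv ν z).toReal - ((V n).rnDeriv ν z).toReal}) ?_).trans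
      ((measureReal_union_le _ _).trans (add_le_add (key _ _ (hV n) hV') ?_))
    · intro z hz
      rw [Set.mem_ofPred_eq, Real.dist_eq, le_abs, neg_sub] at hz
      exact hz
    · rw [tvDist_comm]
      exact key _ _ hV' (hV n)
  · simpa using ((h.div_const 2).div_const ε).add ((h.div_const 2).div_const ε)

/-- Lower semicontinuity of the divergence for convergence in total variation. -/
lemma fdiv_le_of_tendsto (ha : 0 < a) {V R : ℕ → Measure Z} {V' R' : Measure Z}
    [∀ n, IsProbabilityMeasure (V n)] [∀ n, IsProbabilityMeasure (R n)]
    [IsProbabilityMeasure V'] [IsProbabilityMeasure R']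
    (hV : Tendsto (fun n => tvDist (V n) V') atTop (𝓝 0))
    (hR : Tendsto (fun n => tvDist (R n) R') atTop (𝓝 0)) {c : ℕ → ℝ≥0∞} {c' : ℝ≥0∞}
    (hc : Tendsto c atTop (𝓝 c')) (hle : ∀ n, fdiv a (V n) (R n) ≤ c n) :
    fdiv a V' R' ≤ c' := by
  -- A single finite measure dominating both sequences and both limits makes all densities
  -- comparable.
  obtain ⟨ν, hν, hac, -⟩ := exists_isFiniteMeasure_absolutelyContinuous
    (Measure.sum V + Measure.sum R + (V' + R'))
  have hVν : ∀ n, V n ≪ ν := fun n => ((Measure.le_sum V n).absolutelyContinuous.trans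
    ((Measure.AbsolutelyContinuous.rfl.add_right _).add_right _)).trans hac
  have hRν : ∀ n, R n ≪ ν := fun n => ((Measure.le_sum R n).absolutelyContinuous.trans
    ((Measure.AbsolutelyContinuous.rfl.add_right' _).add_right _)).trans hac
  have hV'ν : V' ≪ ν :=
    ((Measure.AbsolutelyContinuous.rfl.add_right _).add_right' _).trans hac
  have hR'ν : R' ≪ ν :=
    ((Measure.AbsolutelyContinuous.rfl.add_right' _).add_right' _).trans hac
  obtain ⟨s, hs, hsV⟩ := (tendstoInMeasure_rnDeriv hVν hV'ν hV).exists_seq_tendsto_ae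
  -- The second extraction is made along the first, so both families of densities converge almost
  -- everywhere along s ∘ r. Fatou's lemma then applies.
  obtain ⟨r, hr, hrR⟩ := (tendstoInMeasure_rnDeriv (fun n => hRν (s n)) hR'ν
    (hR.comp hs.tendsto_atTop)).exists_seq_tendsto_ae
  have hfin : ∀ (U : ℕ → Measure Z) [∀ n, IsProbabilityMeasure (U n)], ∀ᵐ z ∂ν, ∀ n,
      (U n).rnDeriv ν z < ∞ := fun U _ => ae_all_iff.2 fun n => Measure.rnDeriv_lt_top _ _
  rw [fdiv_eq_lintegral a hV'ν hR'ν]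
  calc ∫⁻ z, persp a (V'.rnDeriv ν z) (R'.rnDeriv ν z) ∂ν
      ≤ ∫⁻ z, liminf (fun n => persp a ((V (s (r n))).rnDeriv ν z)
          ((R (s (r n))).rnDeriv ν z)) atTop ∂ν := by
        refine lintegral_mono_ae ?_
        filter_upwards [hsV, hrR, hfin V, hfin R, Measure.rnDeriv_lt_top V' ν,
          Measure.rnDeriv_lt_top R' ν] with z h1 h2 h3 h4 h5 h6
        refine persp_le_liminf ha ?_ ?_ h5.ne h6.ne
        · have := ENNReal.tendsto_ofReal (h1.comp hr.tendsto_atTop)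
          rw [ENNReal.ofReal_toReal h5.ne] at this
          exact this.congr fun n => ENNReal.ofReal_toReal (h3 _).ne
        · have := ENNReal.tendsto_ofReal h2
          rw [ENNReal.ofReal_toReal h6.ne] at this
          exact this.congr fun n => ENNReal.ofReal_toReal (h4 _).ne
    _ ≤ liminf (fun n => ∫⁻ z, persp a ((V (s (r n))).rnDeriv ν z)
          ((R (s (r n))).rnDeriv ν z) ∂ν) atTop :=
        lintegral_liminf_le fun n => (measurable_persp a).comp
          ((Measure.measurable_rnDeriv _ _).prodMk (Measure.measurable_rnDeriv _ _))
    _ ≤ liminf (fun n => c (s (r n))) atTop := by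
        refine liminf_le_liminf (.of_forall fun n => ?_)
        rw [← fdiv_eq_lintegral a (hVν _) (hRν _)]
        exact hle _
    _ = c' := ((hc.comp hs.tendsto_atTop).comp hr.tendsto_atTop).liminf_eq

end FDivergence

end Renyi

namespace Renyi

/-! ### Power integrals and relative entropy as f-divergences. -/

section PowerIntegral

variable {Z : Type*} [MeasurableSpace Z] {a : ℝ}

lemma rpow_mul_rpow_one_sub (ha : 0 < a) {w q : ℝ≥0∞} (hq0 : q ≠ 0) (hq : q ≠ ∞) :
    w ^ a * q ^ (1 - a) = q * (w / q) ^ a := by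
  conv_lhs => rw [← ENNReal.div_mul_cancel (b := w) hq0 hq]
  rw [ENNReal.mul_rpow_of_nonneg _ _ ha.le, mul_assoc, ← ENNReal.rpow_add _ _ hq0 hq,
    add_sub_cancel, ENNReal.rpow_one, mul_comm]

/-- The definition of the generator with its terms distributed so that no subtraction occurs in
`ℝ≥0∞`. The slope a / (1 - a) is the value that keeps it true at q = 0. -/
lemma rpow_mul_rpow_add_persp (ha : 0 < a) (ha1 : a < 1) {w q : ℝ≥0∞} (hw : w ≠ ∞) (hq : q ≠ ∞) :
    w ^ a * q ^ (1 - a) + ENNReal.ofReal (1 - a) * persp a w q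
      = ENNReal.ofReal a * w + ENNReal.ofReal (1 - a) * q := by
  have h1 : 0 < 1 - a := by linarith
  by_cases hq0 : q = 0
  · subst hq0
    rw [ENNReal.zero_rpow_of_pos h1, persp, if_pos rfl, genSlope, if_pos ha1, ← mul_assoc,
      ← ENNReal.ofReal_mul h1.le, mul_div_cancel₀ _ h1.ne', mul_zero, mul_zero, zero_add, add_zero]
  · rw [rpow_mul_rpow_one_sub ha hq0 hq, persp, if_neg hq0]
    have hwq : w = q * (w / q) := (ENNReal.mul_div_cancel hq0 hq).symm
    have ht : w / q = ENNReal.ofReal (w / q).toReal :=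
      (ENNReal.ofReal_toReal (ENNReal.div_ne_top hw hq0)).symm
    nth_rw 3 [hwq]
    set t := (w / q).toReal with ht'
    have ht0 : 0 ≤ t := ENNReal.toReal_nonneg
    rw [ht, ENNReal.ofReal_rpow_of_nonneg ht0 ha.le]
    have key : ENNReal.ofReal (t ^ a) + ENNReal.ofReal (1 - a) * ENNReal.ofReal (gen a t)
        = ENNReal.ofReal a * ENNReal.ofReal t + ENNReal.ofReal (1 - a) := by
      rw [← ENNReal.ofReal_mul h1.le, ← ENNReal.ofReal_mul ha.le,
        ← ENNReal.ofReal_add (by positivity) (mul_nonneg h1.le (gen_nonneg ha ht0)),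
        ← ENNReal.ofReal_add (by positivity) h1.le, gen_of_ne_one ha1.ne]
      congr 1
      have : a - 1 ≠ 0 := by linarith
      field_simp
      ring
    calc _ = q * (ENNReal.ofReal (t ^ a) + ENNReal.ofReal (1 - a) * ENNReal.ofReal (gen a t)) := by
          ring
      _ = _ := by rw [key]; ring

/-- The counterpart for a > 1, where the sign of a - 1 moves terms to the other side. At q = 0 < w
both sides are infinite. -/
lemma rpow_mul_rpow_add_eq (ha1 : 1 < a) {w q : ℝ≥0∞} (hw : w ≠ ∞) (hq : q ≠ ∞) :
    w ^ a * q ^ (1 - a) + ENNReal.ofReal (a - 1) * q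
      = ENNReal.ofReal (a - 1) * persp a w q + ENNReal.ofReal a * w := by
  have ha : 0 < a := by linarith
  have h1 : 0 < a - 1 := by linarith
  by_cases hq0 : q = 0
  · subst hq0
    rw [ENNReal.zero_rpow_of_neg (by linarith), persp, if_pos rfl, genSlope, if_neg (by linarith)]
    by_cases hw0 : w = 0
    · simp [hw0, ha]
    · rw [ENNReal.mul_top, ENNReal.top_mul hw0, ENNReal.mul_top]
      · simp
      · exact (ENNReal.ofReal_pos.2 h1).ne'
      · exact (ENNReal.rpow_pos (pos_iff_ne_zero.2 hw0) hw).ne'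
  · rw [rpow_mul_rpow_one_sub ha hq0 hq, persp, if_neg hq0]
    have hwq : w = q * (w / q) := (ENNReal.mul_div_cancel hq0 hq).symm
    have ht : w / q = ENNReal.ofReal (w / q).toReal :=
      (ENNReal.ofReal_toReal (ENNReal.div_ne_top hw hq0)).symm
    nth_rw 3 [hwq]
    set t := (w / q).toReal with ht'
    have ht0 : 0 ≤ t := ENNReal.toReal_nonneg
    rw [ht, ENNReal.ofReal_rpow_of_nonneg ht0 ha.le]
    have key : ENNReal.ofReal (t ^ a) + ENNReal.ofReal (a - 1)
        = ENNReal.ofReal (a - 1) * ENNReal.ofReal (gen a t)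
          + ENNReal.ofReal a * ENNReal.ofReal t := by
      rw [← ENNReal.ofReal_mul h1.le, ← ENNReal.ofReal_mul ha.le,
        ← ENNReal.ofReal_add (by positivity) h1.le,
        ← ENNReal.ofReal_add (mul_nonneg h1.le (gen_nonneg ha ht0)) (by positivity),
        gen_of_ne_one ha1.ne']
      congr 1
      field_simp
      ring
    calc _ = q * (ENNReal.ofReal (t ^ a) + ENNReal.ofReal (a - 1)) := by ring
      _ = _ := by rw [key]; ring

lemma rpow_homogeneous {a : ℝ} (ha : 0 < a) (c w q : ℝ≥0∞) (hc : c ≠ ∞) :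
    (c * w) ^ a * (c * q) ^ (1 - a) = c * (w ^ a * q ^ (1 - a)) := by
  by_cases hc0 : c = 0
  · simp [hc0, ha]
  · rw [ENNReal.mul_rpow_of_nonneg _ _ ha.le, ENNReal.mul_rpow_eq_ite, if_neg (by simp [hc, hc0])]
    calc _ = (c ^ a * c ^ (1 - a)) * (w ^ a * q ^ (1 - a)) := by ring
      _ = _ := by rw [← ENNReal.rpow_add _ _ hc0 hc, add_sub_cancel, ENNReal.rpow_one]

lemma measurable_rpow_mul (a : ℝ) :
    Measurable (Function.uncurry fun w q : ℝ≥0∞ => w ^ a * q ^ (1 - a)) :=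
  (measurable_fst.pow_const _).mul (measurable_snd.pow_const _)

/-- The integral `∫ w ^ a q ^ (1 - a)` with reference measure `W + Q`. -/
noncomputable def powInt (a : ℝ) (W Q : Measure Z) : ℝ≥0∞ :=
  ∫⁻ z, W.rnDeriv (W + Q) z ^ a * Q.rnDeriv (W + Q) z ^ (1 - a) ∂(W + Q)

lemma powInt_eq_lintegral (ha : 0 < a) {W Q ν : Measure Z} [IsFiniteMeasure W] [IsFiniteMeasure Q]
    [SigmaFinite ν] (hW : W ≪ ν) (hQ : Q ≪ ν) :
    powInt a W Q = ∫⁻ z, W.rnDeriv ν z ^ a * Q.rnDeriv ν z ^ (1 - a) ∂ν :=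
  lintegral_rnDeriv_add_eq (measurable_rpow_mul a) (rpow_homogeneous ha) hW hQ

variable {W Q : Measure Z} [IsProbabilityMeasure W] [IsProbabilityMeasure Q]

lemma lintegral_rnDeriv_add_left : ∫⁻ z, W.rnDeriv (W + Q) z ∂(W + Q) = 1 := by
  rw [Measure.lintegral_rnDeriv (Measure.AbsolutelyContinuous.rfl.add_right _), measure_univ]

lemma lintegral_rnDeriv_add_right : ∫⁻ z, Q.rnDeriv (W + Q) z ∂(W + Q) = 1 := by
  rw [Measure.lintegral_rnDeriv (Measure.AbsolutelyContinuous.rfl.add_right' _), measure_univ]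

/-- Integration of the pointwise identity; the right side becomes a + (1 - a) because both masses
are one. -/
lemma powInt_add_fdiv (ha : 0 < a) (ha1 : a < 1) :
    powInt a W Q + ENNReal.ofReal (1 - a) * fdiv a W Q = 1 := by
  have hmW := Measure.measurable_rnDeriv W (W + Q)
  have hmQ := Measure.measurable_rnDeriv Q (W + Q)
  have hm : Measurable fun z => persp a (W.rnDeriv (W + Q) z) (Q.rnDeriv (W + Q) z) :=
    (measurable_persp a).comp (hmW.prodMk hmQ)
  have hmp : Measurable fun z => W.rnDeriv (W + Q) z ^ a * Q.rnDeriv (W + Q) z ^ (1 - a) :=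
    (hmW.pow_const _).mul (hmQ.pow_const _)
  rw [powInt, fdiv, ← lintegral_const_mul _ hm,
    ← lintegral_add_left hmp]
  calc _ = ∫⁻ z, (ENNReal.ofReal a * W.rnDeriv (W + Q) z
          + ENNReal.ofReal (1 - a) * Q.rnDeriv (W + Q) z) ∂(W + Q) := by
        refine lintegral_congr_ae ?_
        filter_upwards [Measure.rnDeriv_lt_top W (W + Q), Measure.rnDeriv_lt_top Q (W + Q)]
          with z h1 h2
        exact rpow_mul_rpow_add_persp ha ha1 h1.ne h2.ne
    _ = ENNReal.ofReal a * 1 + ENNReal.ofReal (1 - a) * 1 := by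
        rw [lintegral_add_left (hmW.const_mul _), lintegral_const_mul _ hmW,
          lintegral_const_mul _ hmQ, lintegral_rnDeriv_add_left, lintegral_rnDeriv_add_right]
    _ = 1 := by
        rw [mul_one, mul_one, ← ENNReal.ofReal_add ha.le (by linarith), add_sub_cancel,
          ENNReal.ofReal_one]

lemma powInt_eq_one_add_fdiv (ha1 : 1 < a) :
    powInt a W Q = 1 + ENNReal.ofReal (a - 1) * fdiv a W Q := by
  have hmW := Measure.measurable_rnDeriv W (W + Q)
  have hmQ := Measure.measurable_rnDeriv Q (W + Q)
  have hm : Measurable fun z => persp a (W.rnDeriv (W + Q) z) (Q.rnDeriv (W + Q) z) :=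
    (measurable_persp a).comp (hmW.prodMk hmQ)
  have hmp : Measurable fun z => W.rnDeriv (W + Q) z ^ a * Q.rnDeriv (W + Q) z ^ (1 - a) :=
    (hmW.pow_const _).mul (hmQ.pow_const _)
  have key : powInt a W Q + ENNReal.ofReal (a - 1) * 1
      = ENNReal.ofReal (a - 1) * fdiv a W Q + ENNReal.ofReal a * 1 := by
    rw [powInt, fdiv]
    nth_rw 1 [← lintegral_rnDeriv_add_right (W := W) (Q := Q)]
    nth_rw 1 [← lintegral_rnDeriv_add_left (W := W) (Q := Q)]
    rw [← lintegral_const_mul _ hm, ← lintegral_const_mul _ hmW, ← lintegral_const_mul _ hmQ,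
      ← lintegral_add_left hmp,
      ← lintegral_add_left (hm.const_mul _)]
    refine lintegral_congr_ae ?_
    filter_upwards [Measure.rnDeriv_lt_top W (W + Q), Measure.rnDeriv_lt_top Q (W + Q)]
      with z h1 h2
    exact rpow_mul_rpow_add_eq ha1 h1.ne h2.ne
  rw [mul_one, mul_one] at key
  have h2 : ENNReal.ofReal a = 1 + ENNReal.ofReal (a - 1) := by
    rw [← ENNReal.ofReal_one, ← ENNReal.ofReal_add zero_le_one (by linarith), add_sub_cancel]
  rw [h2, ← add_assoc] at key
  rw [(ENNReal.add_left_inj ENNReal.ofReal_ne_top).1 key, add_comm]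

/-- The correction term in `klDiv` is the integral of the summand 1 - t of the generator. Without
absolute continuity both sides are infinite: a finite `fdiv 1` forces the density of W to vanish
where that of Q does, the slope at infinity being ∞. -/
lemma klDiv_eq_fdiv (W Q : Measure Z) [IsFiniteMeasure W] [IsFiniteMeasure Q] :
    InformationTheory.klDiv W Q = fdiv 1 W Q := by
  by_cases h : W ≪ Q
  · rw [InformationTheory.klDiv_eq_lintegral_klFun_of_ac h,
      fdiv_eq_lintegral 1 h Measure.AbsolutelyContinuous.rfl]
    refine lintegral_congr_ae ?_
    filter_upwards [Measure.rnDeriv_self Q] with z hz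
    rw [hz, persp, if_neg one_ne_zero, one_mul, gen_eq_klFun, div_one]
  · rw [InformationTheory.klDiv_of_not_ac h]
    by_contra hne
    refine h (Measure.AbsolutelyContinuous.mk fun E hE hQE => ?_)
    have hW : W ≪ W + Q := Measure.AbsolutelyContinuous.rfl.add_right _
    have hQ : Q ≪ W + Q := Measure.AbsolutelyContinuous.rfl.add_right' _
    have hmW := Measure.measurable_rnDeriv W (W + Q)
    have hmQ := Measure.measurable_rnDeriv Q (W + Q)
    have hfin := ae_lt_top ((measurable_persp 1).comp (hmW.prodMk hmQ))
      (show (∫⁻ z, persp 1 (W.rnDeriv (W + Q) z) (Q.rnDeriv (W + Q) z) ∂(W + Q)) ≠ ∞ from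
        fun h => hne h.symm)
    rw [← Measure.setLIntegral_rnDeriv' hQ hE, lintegral_eq_zero_iff hmQ] at hQE
    rw [← Measure.setLIntegral_rnDeriv' hW hE, lintegral_eq_zero_iff hmW]
    filter_upwards [hQE, ae_restrict_of_ae hfin] with z h1 h2
    simp only [Function.comp_apply, Function.uncurry_apply_pair] at h2
    rw [Pi.zero_apply] at h1
    rw [h1, persp, if_pos rfl, genSlope, if_neg (lt_irrefl _)] at h2
    by_contra h3
    rw [ENNReal.top_mul h3] at h2
    exact lt_irrefl _ h2

end PowerIntegral

/-! ### Sublevel sets of the Rényi divergence. -/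

section Threshold

variable {Z : Type*} [MeasurableSpace Z]

/-- The `f`-divergence with generator `gen a` that corresponds to an order `a` divergence `c`. -/
noncomputable def fdivOf (a c : ℝ) : ℝ :=
  if a = 1 then c else (Real.exp ((a - 1) * c) - 1) / (a - 1)

variable {a : ℝ}

lemma continuous_fdivOf (a : ℝ) : Continuous (fdivOf a) := by
  unfold fdivOf
  split_ifs <;> fun_prop

@[simp] lemma fdivOf_zero (a : ℝ) : fdivOf a 0 = 0 := by simp [fdivOf]

lemma strictMono_fdivOf (a : ℝ) : StrictMono (fdivOf a) := by
  intro x y hxy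
  unfold fdivOf
  rcases lt_trichotomy a 1 with h | h | h
  · rw [if_neg h.ne, if_neg h.ne]
    refine div_lt_div_of_neg_of_lt (by linarith) (sub_lt_sub_right (Real.exp_lt_exp.2 ?_) _)
    exact mul_lt_mul_of_neg_left hxy (by linarith)
  · rwa [if_pos h, if_pos h]
  · rw [if_neg h.ne', if_neg h.ne']
    refine div_lt_div_of_pos_right (sub_lt_sub_right (Real.exp_lt_exp.2 ?_) _) (by linarith)
    exact mul_lt_mul_of_pos_left hxy (by linarith)

lemma log_le_coe_iff {x : ℝ≥0∞} {c : ℝ} :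
    ENNReal.log x ≤ (c : EReal) ↔ x ≤ ENNReal.ofReal (Real.exp c) := by
  rw [← ENNReal.log_le_log_iff, ENNReal.log_ofReal_of_pos (Real.exp_pos c), Real.log_exp]

lemma divergence_eq_powInt {α : ℝ≥0∞} (h0 : α ≠ 0) (h1 : α ≠ 1) (ht : α ≠ ∞) (W Q : Measure Z) :
    divergence α W Q
      = (((α.toReal - 1)⁻¹ : ℝ) : EReal) * ENNReal.log (powInt α.toReal W Q) := by
  rw [divergence, if_neg h0, if_neg h1, if_neg ht, powInt]

lemma divergence_one_eq (W Q : Measure Z) [IsProbabilityMeasure W] [IsProbabilityMeasure Q] :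
    divergence 1 W Q = (fdiv 1 W Q : EReal) := by
  rw [divergence, if_neg one_ne_zero, if_pos rfl, klDiv_eq_fdiv, measure_univ, measure_univ,
    EReal.coe_ennreal_one, show (1 : EReal) = ((1 : ℝ) : EReal) from rfl,
    EReal.add_sub_cancel_right]

lemma toReal_ne_one {α : ℝ≥0∞} (h1 : α ≠ 1) : α.toReal ≠ 1 := by
  intro h
  exact h1 ((ENNReal.toReal_eq_one_iff α).1 h)

/-- Sublevel sets of the divergence of a finite order. -/
lemma divergence_le_iff {α : ℝ≥0∞} (h0 : α ≠ 0) (ht : α ≠ ∞) (W Q : Measure Z)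
    [IsProbabilityMeasure W] [IsProbabilityMeasure Q] (c : ℝ) :
    divergence α W Q ≤ c ↔ 0 ≤ c ∧ fdiv α.toReal W Q ≤ ENNReal.ofReal (fdivOf α.toReal c) := by
  -- The condition 0 ≤ c is not redundant: for c < 0 the right-hand bound is truncated to 0 by
  -- `ENNReal.ofReal` and would still hold for W = Q.
  have ha : 0 < α.toReal := ENNReal.toReal_pos h0 ht
  by_cases h1 : α = 1
  · subst h1
    rw [divergence_one_eq, ENNReal.toReal_one, fdivOf, if_pos rfl]
    constructor
    · intro h
      have hc : 0 ≤ c := by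
        have : ((0 : ℝ) : EReal) ≤ c := (EReal.coe_ennreal_nonneg _).trans h
        exact_mod_cast this
      refine ⟨hc, ?_⟩
      rw [← EReal.coe_ennreal_le_coe_ennreal_iff, EReal.coe_ennreal_ofReal, max_eq_left hc]
      exact h
    · rintro ⟨hc, h⟩
      rw [← EReal.coe_ennreal_le_coe_ennreal_iff, EReal.coe_ennreal_ofReal, max_eq_left hc] at h
      exact h
  rw [divergence_eq_powInt h0 h1 ht, ← ENNReal.log_rpow, log_le_coe_iff]
  have h1' := toReal_ne_one h1
  generalize α.toReal = a at *
  rw [fdivOf, if_neg h1']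
  have he : ∀ x : ℝ, 0 < x → ENNReal.ofReal (Real.exp c) ^ x = ENNReal.ofReal (Real.exp (x * c)) := by
    intro x hx
    rw [ENNReal.ofReal_rpow_of_nonneg (Real.exp_pos c).le hx.le, ← Real.exp_mul, mul_comm]
  rcases lt_or_gt_of_ne h1' with h | h
  · have hpos : 0 < 1 - a := by linarith
    have hadd := powInt_add_fdiv (W := W) (Q := Q) ha h
    have hX : powInt a W Q ≠ ∞ := ne_top_of_le_ne_top ENNReal.one_ne_top (hadd ▸ le_self_add)
    have hF : fdiv a W Q ≠ ∞ := by
      intro hF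
      rw [hF, ENNReal.mul_top (ENNReal.ofReal_pos.2 hpos).ne'] at hadd
      simp at hadd
    -- For a < 1 the exponent (a - 1)⁻¹ is negative, so an upper bound on the divergence is a lower
    -- bound on the power integral.
    have hlhs : powInt a W Q ^ (a - 1)⁻¹ ≤ ENNReal.ofReal (Real.exp c) ↔
        ENNReal.ofReal (Real.exp ((a - 1) * c)) ≤ powInt a W Q := by
      rw [show (a - 1)⁻¹ = -((1 - a)⁻¹) by rw [← inv_neg, neg_sub], ENNReal.rpow_neg,
        ← ENNReal.inv_rpow, ENNReal.rpow_inv_le_iff hpos, he _ hpos, ENNReal.inv_le_iff_inv_le,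
        ← ENNReal.ofReal_inv_of_pos (Real.exp_pos _), ← Real.exp_neg]
      ring_nf
    rw [hlhs]
    have hreal : (powInt a W Q).toReal + (1 - a) * (fdiv a W Q).toReal = 1 := by
      have := congrArg ENNReal.toReal hadd
      rwa [ENNReal.toReal_add hX (ENNReal.mul_ne_top ENNReal.ofReal_ne_top hF), ENNReal.toReal_mul,
        ENNReal.toReal_ofReal hpos.le, ENNReal.toReal_one] at this
    have hF0 : 0 ≤ (fdiv a W Q).toReal := ENNReal.toReal_nonneg
    rw [ENNReal.ofReal_le_iff_le_toReal hX]
    have hiff : Real.exp ((a - 1) * c) ≤ (powInt a W Q).toReal ↔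
        (fdiv a W Q).toReal ≤ (Real.exp ((a - 1) * c) - 1) / (a - 1) := by
      rw [← neg_div_neg_eq, neg_sub, neg_sub, le_div_iff₀ hpos]
      constructor <;> intro h <;> linarith
    rw [hiff]
    constructor
    · intro hle
      have h3 : 0 ≤ (Real.exp ((a - 1) * c) - 1) / (a - 1) := hF0.trans hle
      refine ⟨?_, (ENNReal.le_ofReal_iff_toReal_le hF h3).2 hle⟩
      rw [← neg_div_neg_eq, neg_sub, neg_sub] at h3
      have h4 : Real.exp ((a - 1) * c) ≤ 1 := by
        have := mul_nonneg h3 hpos.le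
        rw [div_mul_cancel₀ _ hpos.ne'] at this
        linarith
      rw [Real.exp_le_one_iff] at h4
      by_contra hc
      nlinarith [mul_pos hpos (show 0 < -c by linarith)]
    · rintro ⟨hc, hle⟩
      refine (ENNReal.le_ofReal_iff_toReal_le hF ?_).1 hle
      refine div_nonneg_of_nonpos (sub_nonpos.2 (Real.exp_le_one_iff.2 ?_)) (by linarith)
      nlinarith [mul_nonneg hpos.le hc]
  · have hpos : 0 < a - 1 := by linarith
    rw [ENNReal.rpow_inv_le_iff hpos, he _ hpos, powInt_eq_one_add_fdiv h]
    constructor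
    · intro hle
      have h4 : 1 ≤ Real.exp ((a - 1) * c) := by
        rw [← ENNReal.one_le_ofReal]
        exact le_self_add.trans hle
      refine ⟨?_, ?_⟩
      · rw [Real.one_le_exp_iff] at h4
        exact nonneg_of_mul_nonneg_right h4 hpos
      · rw [ENNReal.ofReal_div_of_pos hpos, ENNReal.le_div_iff_mul_le
          (Or.inl (ENNReal.ofReal_pos.2 hpos).ne') (Or.inl ENNReal.ofReal_ne_top),
          ENNReal.ofReal_sub (Real.exp _) zero_le_one, ENNReal.ofReal_one, mul_comm]
        exact ENNReal.le_sub_of_add_le_left ENNReal.one_ne_top hle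
    · rintro ⟨hc, hle⟩
      have h4 : 1 ≤ Real.exp ((a - 1) * c) := Real.one_le_exp_iff.2 (by positivity)
      rw [ENNReal.ofReal_div_of_pos hpos, ENNReal.le_div_iff_mul_le
          (Or.inl (ENNReal.ofReal_pos.2 hpos).ne') (Or.inl ENNReal.ofReal_ne_top), mul_comm] at hle
      calc 1 + ENNReal.ofReal (a - 1) * fdiv a W Q
          ≤ ENNReal.ofReal 1 + ENNReal.ofReal (Real.exp ((a - 1) * c) - 1) := by
            rw [ENNReal.ofReal_one]; gcongr
        _ = _ := by rw [← ENNReal.ofReal_add zero_le_one (by linarith), add_sub_cancel]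

/-- Sublevel sets of the divergence of order `∞`. -/
lemma divergence_top_le_iff (W Q : Measure Z) [IsFiniteMeasure W] [IsFiniteMeasure Q] (c : ℝ) :
    divergence ∞ W Q ≤ c ↔ W ≤ ENNReal.ofReal (Real.exp c) • Q := by
  have hC : ENNReal.ofReal (Real.exp c) ≠ 0 := (ENNReal.ofReal_pos.2 (Real.exp_pos c)).ne'
  have hC' : ENNReal.ofReal (Real.exp c) ≠ ∞ := ENNReal.ofReal_ne_top
  rw [divergence, if_neg ENNReal.top_ne_zero, if_neg ENNReal.top_ne_one, if_pos rfl, log_le_coe_iff]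
  generalize ENNReal.ofReal (Real.exp c) = C at *
  have hW : W ≪ W + Q := Measure.AbsolutelyContinuous.rfl.add_right _
  have hQ : Q ≪ W + Q := Measure.AbsolutelyContinuous.rfl.add_right' _
  have hmW := Measure.measurable_rnDeriv W (W + Q)
  have hmQ := Measure.measurable_rnDeriv Q (W + Q)
  have hiff : essSup (fun z => W.rnDeriv (W + Q) z / Q.rnDeriv (W + Q) z) (W + Q) ≤ C ↔
      ∀ᵐ z ∂(W + Q), W.rnDeriv (W + Q) z ≤ C * Q.rnDeriv (W + Q) z := by
    have hdiv : ∀ᵐ z ∂(W + Q), (W.rnDeriv (W + Q) z / Q.rnDeriv (W + Q) z ≤ C ↔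
        W.rnDeriv (W + Q) z ≤ C * Q.rnDeriv (W + Q) z) := by
      filter_upwards [Measure.rnDeriv_lt_top Q (W + Q)] with z hz
      exact ENNReal.div_le_iff_le_mul (Or.inr hC') (Or.inl hz.ne)
    constructor
    · intro h
      filter_upwards [ENNReal.ae_le_essSup _, hdiv] with z h1 h2 using h2.1 (h1.trans h)
    · intro h
      refine essSup_le_of_ae_le C ?_
      filter_upwards [h, hdiv] with z h1 h2 using h2.2 h1
  rw [hiff]
  constructor
  · intro h
    refine Measure.le_iff.2 fun E hE => ?_
    rw [Measure.smul_apply, smul_eq_mul, ← Measure.setLIntegral_rnDeriv' hW hE,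
      ← Measure.setLIntegral_rnDeriv' hQ hE, ← lintegral_const_mul _ hmQ]
    exact lintegral_mono_ae (ae_restrict_of_ae h)
  · intro h
    refine ae_le_of_forall_setLIntegral_le_of_sigmaFinite hmW fun E hE _ => ?_
    rw [lintegral_const_mul _ hmQ, Measure.setLIntegral_rnDeriv' hW hE,
      Measure.setLIntegral_rnDeriv' hQ hE]
    exact Measure.le_iff.1 h E hE

end Threshold

end Renyi

namespace Renyi

/-! ### Positivity, control of total variation and lower semicontinuity of the Rényi divergence. -/

section DivergenceProperties

variable {Z : Type*} [MeasurableSpace Z] {α : ℝ≥0∞}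

lemma nonneg_of_divergence_le (h0 : α ≠ 0) {W Q : Measure Z} [IsProbabilityMeasure W]
    [IsProbabilityMeasure Q] {c : ℝ} (h : divergence α W Q ≤ c) : 0 ≤ c := by
  by_cases ht : α = ∞
  · subst ht
    have h1 := Measure.le_iff'.1 ((divergence_top_le_iff W Q c).1 h) Set.univ
    rw [Measure.smul_apply, measure_univ, measure_univ, smul_eq_mul, mul_one,
      ENNReal.one_le_ofReal, Real.one_le_exp_iff] at h1
    exact h1
  · exact ((divergence_le_iff h0 ht W Q c).1 h).1

lemma divergence_nonneg (h0 : α ≠ 0) (W Q : Measure Z) [IsProbabilityMeasure W]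
    [IsProbabilityMeasure Q] : 0 ≤ divergence α W Q := by
  by_contra! h
  obtain ⟨c, hc, hc0⟩ := EReal.lt_iff_exists_real_btwn.1 h
  have h1 := nonneg_of_divergence_le h0 hc.le
  exact absurd (EReal.coe_nonneg.2 h1) (not_le.2 hc0)

lemma divergence_self (h0 : α ≠ 0) (W : Measure Z) [IsProbabilityMeasure W] :
    divergence α W W = 0 := by
  refine le_antisymm ?_ (divergence_nonneg h0 W W)
  rw [← EReal.coe_zero]
  by_cases ht : α = ∞
  · subst ht
    rw [divergence_top_le_iff, Real.exp_zero, ENNReal.ofReal_one, one_smul]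
  · rw [divergence_le_iff h0 ht, fdiv_self]
    exact ⟨le_rfl, zero_le⟩

/-- A small divergence forces a small total variation distance. -/
lemma exists_tvDist_le_of_divergence_le (h0 : α ≠ 0) {ε : ℝ} (hε : 0 < ε) :
    ∃ δ : ℝ, 0 < δ ∧ ∀ (W Q : Measure Z) [IsProbabilityMeasure W] [IsProbabilityMeasure Q],
      divergence α W Q ≤ δ → tvDist W Q ≤ ε := by
  by_cases ht : α = ∞
  · subst ht
    refine ⟨Real.log (1 + ε / 2), Real.log_pos (by linarith), fun W Q _ _ h => ?_⟩
    rw [divergence_top_le_iff, Real.exp_log (by positivity)] at h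
    refine tvDist_le fun E _ => ?_
    have h1 : W.real E ≤ (1 + ε / 2) * Q.real E := by
      have h2 := ENNReal.toReal_mono
        (ENNReal.mul_ne_top ENNReal.ofReal_ne_top (measure_ne_top Q E)) (Measure.le_iff'.1 h E)
      rwa [ENNReal.toReal_mul, ENNReal.toReal_ofReal (by positivity)] at h2
    have h3 : Q.real E ≤ 1 := measureReal_le_one
    nlinarith
  · have ha : 0 < α.toReal := ENNReal.toReal_pos h0 ht
    obtain ⟨M, hM, hle⟩ := exists_measure_le_add_fdiv (Z := Z) ha (ε := ε / 4) (by positivity)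
    have hcont := (continuous_fdivOf α.toReal).tendsto 0
    rw [fdivOf_zero] at hcont
    -- Here δ makes M times the f-divergence bound at most ε / 4. With the ε / 4 from the factor of
    -- Q(E) this gives the required ε / 2 on every event.
    have hev := (hcont.mono_left (nhdsWithin_le_nhds (s := Set.Ioi 0))).eventually
      (eventually_le_nhds (show (0 : ℝ) < ε / (4 * M) by positivity))
    obtain ⟨δ, hδ, hδ0⟩ := (hev.and self_mem_nhdsWithin).exists
    refine ⟨δ, hδ0, fun W Q _ _ h => ?_⟩
    have hF := ((divergence_le_iff h0 ht W Q δ).1 h).2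
    have hf0 : 0 ≤ fdivOf α.toReal δ := by
      rw [← fdivOf_zero α.toReal]
      exact (strictMono_fdivOf _).monotone (le_of_lt hδ0)
    refine tvDist_le fun E hE => ?_
    have h1 : W.real E ≤ (1 + ε / 4) * Q.real E + M * fdivOf α.toReal δ := by
      have h2 : W E ≤ ENNReal.ofReal (1 + ε / 4) * Q E +
          ENNReal.ofReal M * ENNReal.ofReal (fdivOf α.toReal δ) :=
        (hle W Q E hE).trans (by gcongr)
      rw [← ofReal_measureReal (μ := Q) (s := E), ← ENNReal.ofReal_mul (by positivity),
        ← ENNReal.ofReal_mul hM.le, ← ENNReal.ofReal_add (by positivity) (by positivity)] at h2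
      exact ENNReal.toReal_le_of_le_ofReal (by positivity) h2
    have h3 : Q.real E ≤ 1 := measureReal_le_one
    have h4 : M * fdivOf α.toReal δ ≤ ε / 4 := by
      calc M * fdivOf α.toReal δ ≤ M * (ε / (4 * M)) := by gcongr
        _ = ε / 4 := by field_simp
    nlinarith

/-- Joint lower semicontinuity of the divergence for convergence in total variation. -/
lemma divergence_le_of_tendsto (h0 : α ≠ 0) {V R : ℕ → Measure Z} {V' R' : Measure Z}
    [∀ n, IsProbabilityMeasure (V n)] [∀ n, IsProbabilityMeasure (R n)]
    [IsProbabilityMeasure V'] [IsProbabilityMeasure R']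
    (hV : Tendsto (fun n => tvDist (V n) V') atTop (𝓝 0))
    (hR : Tendsto (fun n => tvDist (R n) R') atTop (𝓝 0)) {c : ℕ → ℝ} {c' : ℝ}
    (hc : Tendsto c atTop (𝓝 c')) (hle : ∀ n, divergence α (V n) (R n) ≤ c n) :
    divergence α V' R' ≤ c' := by
  by_cases ht : α = ∞
  · subst ht
    rw [divergence_top_le_iff]
    -- For order ∞ the sublevel condition is an inequality on each event, so setwise convergence is
    -- enough.
    have hreal : ∀ {U : ℕ → Measure Z} {U' : Measure Z} [∀ n, IsProbabilityMeasure (U n)]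
        [IsProbabilityMeasure U'], Tendsto (fun n => tvDist (U n) U') atTop (𝓝 0) →
        ∀ E, MeasurableSet E → Tendsto (fun n => U n E) atTop (𝓝 (U' E)) := by
      intro U U' _ _ h E hE
      have h1 : Tendsto (fun n => (U n).real E) atTop (𝓝 (U'.real E)) := by
        rw [tendsto_iff_dist_tendsto_zero]
        refine squeeze_zero (fun _ => dist_nonneg)
          (fun n => (Real.dist_eq _ _).le.trans (abs_real_sub_le_tvDist hE)) ?_
        simpa using h.div_const 2
      exact (ENNReal.tendsto_toReal_iff (fun n => measure_ne_top _ _) (measure_ne_top _ _)).1 h1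
    refine Measure.le_iff.2 fun E hE => ?_
    rw [Measure.smul_apply, smul_eq_mul]
    refine le_of_tendsto_of_tendsto' (hreal hV E hE)
      (ENNReal.Tendsto.mul (ENNReal.tendsto_ofReal ((Real.continuous_exp.tendsto c').comp hc))
        (Or.inr (measure_ne_top R' E)) (hreal hR E hE) (Or.inr ENNReal.ofReal_ne_top)) fun n => ?_
    have := Measure.le_iff'.1 ((divergence_top_le_iff _ _ _).1 (hle n)) E
    rwa [Measure.smul_apply, smul_eq_mul] at this
  · have ha : 0 < α.toReal := ENNReal.toReal_pos h0 ht
    have h1 := fun n => (divergence_le_iff h0 ht _ _ _).1 (hle n)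
    rw [divergence_le_iff h0 ht]
    refine ⟨ge_of_tendsto' hc fun n => (h1 n).1, ?_⟩
    exact fdiv_le_of_tendsto ha hV hR
      (ENNReal.tendsto_ofReal (((continuous_fdivOf _).tendsto c').comp hc)) fun n => (h1 n).2

end DivergenceProperties

end Renyi

namespace Renyi

/-! ### Priors, mixtures and the joint measure. -/

section Prior

variable {Y : Type*} [MeasurableSpace Y]

/-- `P` is a probability mass function with finite support. -/
def IsPrior (P : ProbabilityMeasure Y →₀ ℝ) : Prop :=
  (∀ w, 0 ≤ P w) ∧ ∑ w ∈ P.support, P w = 1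

lemma isPrior_of_mem_priors {𝒲 : Set (ProbabilityMeasure Y)} {P : ProbabilityMeasure Y →₀ ℝ}
    (h : P ∈ priors 𝒲) : IsPrior P := ⟨h.1, h.2.2⟩

variable {P : ProbabilityMeasure Y →₀ ℝ}

lemma IsPrior.pos (hP : IsPrior P) {w : ProbabilityMeasure Y} (hw : w ∈ P.support) : 0 < P w :=
  lt_of_le_of_ne (hP.1 w) (Finsupp.mem_support_iff.1 hw).symm

lemma IsPrior.ofReal_ne_zero (hP : IsPrior P) {w : ProbabilityMeasure Y} (hw : w ∈ P.support) :
    ENNReal.ofReal (P w) ≠ 0 := (ENNReal.ofReal_pos.2 (hP.pos hw)).ne'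

lemma IsPrior.sum_ofReal (hP : IsPrior P) : ∑ w ∈ P.support, ENNReal.ofReal (P w) = 1 := by
  rw [← ENNReal.ofReal_sum_of_nonneg fun w _ => hP.1 w, hP.2, ENNReal.ofReal_one]

lemma IsPrior.support_nonempty (hP : IsPrior P) : P.support.Nonempty := by
  rw [Finset.nonempty_iff_ne_empty]
  intro h
  have := hP.2
  rw [h, Finset.sum_empty] at this
  exact zero_ne_one this

instance : MeasurableSingletonClass (Support P) := ⟨fun _ => trivial⟩

lemma sum_support_eq {M : Type*} [AddCommMonoid M] (g : ProbabilityMeasure Y → M) :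
    ∑ w : Support P, g w.1 = ∑ w ∈ P.support, g w :=
  Finset.sum_coe_sort P.support g

lemma lintegral_priorMeasure (g : ProbabilityMeasure Y → ℝ≥0∞) :
    ∫⁻ w, g w.1 ∂(priorMeasure P) = ∑ w ∈ P.support, ENNReal.ofReal (P w) * g w := by
  rw [priorMeasure, lintegral_finsetSum_measure, ← sum_support_eq]
  refine Finset.sum_congr rfl fun w _ => ?_
  rw [lintegral_smul_measure, lintegral_dirac, smul_eq_mul]

lemma isProbabilityMeasure_priorMeasure (hP : IsPrior P) :
    IsProbabilityMeasure (priorMeasure P) := by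
  refine ⟨?_⟩
  rw [← lintegral_one, lintegral_priorMeasure (fun _ => 1)]
  simpa using hP.sum_ofReal

lemma isProbabilityMeasure_mixture (hP : IsPrior P) : IsProbabilityMeasure (mixture P) := by
  refine ⟨?_⟩
  simpa [mixture] using hP.sum_ofReal

instance : IsFiniteMeasure (mixture P) := ⟨by simp [mixture, ENNReal.sum_lt_top]⟩

lemma mixture_apply (E : Set Y) :
    mixture P E = ∑ w ∈ P.support, ENNReal.ofReal (P w) * (w : Measure Y) E := by
  simp [mixture]

lemma absolutelyContinuous_mixture (hP : IsPrior P) {w : ProbabilityMeasure Y}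
    (hw : w ∈ P.support) : (w : Measure Y) ≪ mixture P := by
  refine Measure.AbsolutelyContinuous.mk fun E _ h => ?_
  rw [mixture_apply, Finset.sum_eq_zero_iff] at h
  exact (mul_eq_zero.1 (h w hw)).resolve_left (hP.ofReal_ne_zero hw)

instance : IsFiniteMeasure (joint P) := by unfold joint; infer_instance

lemma isProbabilityMeasure_joint (hP : IsPrior P) : IsProbabilityMeasure (joint P) := by
  have := isProbabilityMeasure_priorMeasure hP
  unfold joint
  infer_instance

lemma joint_apply {s : Set (Support P × Y)} (hs : MeasurableSet s) :
    joint P s = ∫⁻ w, (w.1 : Measure Y) (Prod.mk w ⁻¹' s) ∂(priorMeasure P) :=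
  Measure.compProd_apply hs

/-- The support is finite and discrete, so measurability in y for each fixed member already gives
joint measurability of the density. -/
lemma joint_eq_withDensity {ν : Measure Y} [SigmaFinite ν]
    (hν : ∀ w ∈ P.support, (w : Measure Y) ≪ ν) :
    joint P = ((priorMeasure P).prod ν).withDensity
      fun z => (z.1.1 : Measure Y).rnDeriv ν z.2 := by
  have hm : Measurable fun z : Support P × Y => (z.1.1 : Measure Y).rnDeriv ν z.2 :=
    measurable_from_prod_countable_right fun w =>
      Measure.measurable_rnDeriv (w.1 : Measure Y) ν
  refine Measure.ext fun s hs => ?_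
  rw [joint_apply hs, withDensity_apply _ hs, ← lintegral_indicator hs,
    lintegral_prod _ (hm.indicator hs).aemeasurable]
  refine lintegral_congr fun w => ?_
  rw [← Measure.setLIntegral_rnDeriv' (hν w.1 w.2) (measurable_prodMk_left hs),
    ← lintegral_indicator (measurable_prodMk_left hs)]
  rfl

/-- Integrals of homogeneous functions of the joint densities split over the support. -/
lemma lintegral_joint_eq_sum {Φ : ℝ≥0∞ → ℝ≥0∞ → ℝ≥0∞} (hΦ : Measurable (Function.uncurry Φ))
    (hhom : ∀ c w q, c ≠ ∞ → Φ (c * w) (c * q) = c * Φ w q)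
    {ν : Measure Y} [SigmaFinite ν] (hν : ∀ w ∈ P.support, (w : Measure Y) ≪ ν)
    (Q : ProbabilityMeasure Y) (hQ : (Q : Measure Y) ≪ ν) :
    ∫⁻ z, Φ ((joint P).rnDeriv (joint P + (priorMeasure P).prod Q) z)
      (((priorMeasure P).prod Q).rnDeriv (joint P + (priorMeasure P).prod Q) z)
        ∂(joint P + (priorMeasure P).prod (Q : Measure Y))
      = ∑ w ∈ P.support, ENNReal.ofReal (P w) *
          ∫⁻ y, Φ ((w : Measure Y).rnDeriv ν y) ((Q : Measure Y).rnDeriv ν y) ∂ν := by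
  set ρ := (priorMeasure P).prod ν
  have hm : Measurable fun z : Support P × Y => (z.1.1 : Measure Y).rnDeriv ν z.2 :=
    measurable_from_prod_countable_right fun w =>
      Measure.measurable_rnDeriv (w.1 : Measure Y) ν
  have hmQ : Measurable ((Q : Measure Y).rnDeriv ν) := Measure.measurable_rnDeriv _ _
  have hj := joint_eq_withDensity hν
  have hq : (priorMeasure P).prod (Q : Measure Y)
      = ρ.withDensity fun z => (Q : Measure Y).rnDeriv ν z.2 := by
    conv_lhs => rw [← Measure.withDensity_rnDeriv_eq _ _ hQ]
    exact prod_withDensity_right hmQ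
  have hjac : joint P ≪ ρ := hj ▸ withDensity_absolutelyContinuous _ _
  have hqac : (priorMeasure P).prod (Q : Measure Y) ≪ ρ := hq ▸ withDensity_absolutelyContinuous _ _
  rw [lintegral_rnDeriv_add_eq hΦ hhom hjac hqac]
  have h1 : (joint P).rnDeriv ρ =ᵐ[ρ] fun z => (z.1.1 : Measure Y).rnDeriv ν z.2 := by
    rw [hj]; exact Measure.rnDeriv_withDensity _ hm
  have h2 : ((priorMeasure P).prod (Q : Measure Y)).rnDeriv ρ =ᵐ[ρ]
      fun z => (Q : Measure Y).rnDeriv ν z.2 := by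
    rw [hq]; exact Measure.rnDeriv_withDensity _ (hmQ.comp measurable_snd)
  have h3 : ∫⁻ z, Φ ((joint P).rnDeriv ρ z) (((priorMeasure P).prod (Q : Measure Y)).rnDeriv ρ z) ∂ρ
      = ∫⁻ z, Φ ((z.1.1 : Measure Y).rnDeriv ν z.2) ((Q : Measure Y).rnDeriv ν z.2) ∂ρ := by
    refine lintegral_congr_ae ?_
    filter_upwards [h1, h2] with z h1 h2
    rw [h1, h2]
  have hm3 : Measurable fun z : Support P × Y =>
      Φ ((z.1.1 : Measure Y).rnDeriv ν z.2) ((Q : Measure Y).rnDeriv ν z.2) :=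
    hΦ.comp (hm.prodMk (hmQ.comp measurable_snd))
  rw [h3, lintegral_prod _ hm3.aemeasurable]
  exact lintegral_priorMeasure
    (fun w : ProbabilityMeasure Y => ∫⁻ y, Φ ((w : Measure Y).rnDeriv ν y) ((Q : Measure Y).rnDeriv ν y) ∂ν)

lemma ac_mixture_add (hP : IsPrior P) {w : ProbabilityMeasure Y} (hw : w ∈ P.support)
    (Q : Measure Y) : (w : Measure Y) ≪ mixture P + Q :=
  (absolutelyContinuous_mixture hP hw).add_right _

/-- For fixed Q the right side is affine in the prior. The mixing argument works with `fdiv` for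
this reason. -/
lemma fdiv_joint (hP : IsPrior P) (a : ℝ) (Q : ProbabilityMeasure Y) :
    fdiv a (joint P) ((priorMeasure P).prod (Q : Measure Y))
      = ∑ w ∈ P.support, ENNReal.ofReal (P w) * fdiv a (w : Measure Y) (Q : Measure Y) := by
  have hQ : (Q : Measure Y) ≪ mixture P + Q := Measure.AbsolutelyContinuous.rfl.add_right' _
  rw [fdiv, lintegral_joint_eq_sum (measurable_persp a) (fun _ _ _ hc => persp_mul a hc)
    (fun w hw => ac_mixture_add hP hw Q) Q hQ]
  refine Finset.sum_congr rfl fun w hw => ?_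
  rw [fdiv_eq_lintegral a (ac_mixture_add hP hw Q) hQ]

end Prior

/-! ### The Rényi mean is a well-defined probability measure. -/

section Mean

variable {Y : Type*} [MeasurableSpace Y] {P : ProbabilityMeasure Y →₀ ℝ} {α : ℝ≥0∞}

lemma measurable_meanDensity (α : ℝ≥0∞) (P : ProbabilityMeasure Y →₀ ℝ) :
    Measurable (meanDensity α P) := by
  unfold meanDensity
  split_ifs
  · exact Finset.measurable_fun_prod _ fun w _ => (Measure.measurable_rnDeriv _ _).pow_const _
  · exact .biSup _ (Finset.countable_toSet P.support) fun w _ => Measure.measurable_rnDeriv _ _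
  · exact (Finset.measurable_fun_sum _ fun w _ =>
      ((Measure.measurable_rnDeriv _ _).pow_const _).const_mul _).pow_const _

lemma meanDensity_rpow (h0 : α ≠ 0) (ht : α ≠ ∞) (y : Y) :
    meanDensity α P y ^ α.toReal = ∑ w ∈ P.support, ENNReal.ofReal (P w) *
      ((w : Measure Y).rnDeriv (mixture P) y) ^ α.toReal := by
  rw [meanDensity, if_neg h0, if_neg ht,
    ENNReal.rpow_inv_rpow (ENNReal.toReal_pos h0 ht).ne']

/-- A power mean is at most the maximum, hence at most the sum, of its entries; the sum is
integrable, so the mean measure has finite mass. -/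
lemma meanDensity_le (hP : IsPrior P) (h0 : α ≠ 0) (y : Y) :
    meanDensity α P y ≤ ∑ w ∈ P.support, (w : Measure Y).rnDeriv (mixture P) y := by
  by_cases ht : α = ∞
  · rw [meanDensity, if_neg h0, if_pos ht]
    exact iSup₂_le fun w hw =>
      Finset.single_le_sum (f := fun w : ProbabilityMeasure Y =>
        (w : Measure Y).rnDeriv (mixture P) y) (fun _ _ => zero_le) hw
  · have ha := ENNReal.toReal_pos h0 ht
    rw [← ENNReal.rpow_le_rpow_iff ha, meanDensity_rpow h0 ht]
    calc _ ≤ ∑ w ∈ P.support, ENNReal.ofReal (P w) *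
          (∑ v ∈ P.support, (v : Measure Y).rnDeriv (mixture P) y) ^ α.toReal := by
          refine Finset.sum_le_sum fun w hw => ?_
          gcongr
          exact Finset.single_le_sum (f := fun w : ProbabilityMeasure Y =>
            (w : Measure Y).rnDeriv (mixture P) y) (fun _ _ => zero_le) hw
      _ = _ := by rw [← Finset.sum_mul, hP.sum_ofReal, one_mul]

/-- A power mean of positive order with positive weights vanishes only if every entry does. Hence
the mean measure has positive mass. -/
lemma rnDeriv_eq_zero_of_meanDensity (hP : IsPrior P) (h0 : α ≠ 0) {y : Y}
    (h : meanDensity α P y = 0) {w : ProbabilityMeasure Y} (hw : w ∈ P.support) :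
    (w : Measure Y).rnDeriv (mixture P) y = 0 := by
  by_cases ht : α = ∞
  · rw [meanDensity, if_neg h0, if_pos ht] at h
    refine le_antisymm (h ▸ ?_) zero_le
    exact le_iSup₂ (f := fun (w : ProbabilityMeasure Y) (_ : w ∈ P.support) =>
      (w : Measure Y).rnDeriv (mixture P) y) w hw
  · have ha := ENNReal.toReal_pos h0 ht
    have h1 := meanDensity_rpow (P := P) h0 ht y
    rw [h, ENNReal.zero_rpow_of_pos ha, eq_comm, Finset.sum_eq_zero_iff] at h1
    exact (ENNReal.rpow_eq_zero_iff_of_pos ha).1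
      ((mul_eq_zero.1 (h1 w hw)).resolve_left (hP.ofReal_ne_zero hw))

lemma meanMeasure_univ_ne_top (hP : IsPrior P) (h0 : α ≠ 0) :
    meanMeasure α P Set.univ ≠ ∞ := by
  rw [meanMeasure, withDensity_apply _ MeasurableSet.univ, setLIntegral_univ]
  refine ((lintegral_mono (meanDensity_le hP h0)).trans_lt ?_).ne
  rw [lintegral_finsetSum _ fun w _ => Measure.measurable_rnDeriv _ _]
  exact ENNReal.sum_lt_top.2 fun w _ => Measure.lintegral_rnDeriv_lt_top _ _

lemma meanMeasure_univ_ne_zero (hP : IsPrior P) (h0 : α ≠ 0) :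
    meanMeasure α P Set.univ ≠ 0 := by
  intro h
  rw [meanMeasure, withDensity_apply _ MeasurableSet.univ, setLIntegral_univ,
    lintegral_eq_zero_iff (measurable_meanDensity α P)] at h
  obtain ⟨w, hw⟩ := hP.support_nonempty
  have h1 := Measure.lintegral_rnDeriv (absolutelyContinuous_mixture hP hw)
  rw [measure_univ, lintegral_eq_zero_of_ae_eq_zero] at h1
  · exact zero_ne_one h1
  · filter_upwards [h] with y hy
    exact rnDeriv_eq_zero_of_meanDensity hP h0 hy hw

lemma isProbabilityMeasure_renyiMean (hP : IsPrior P) (h0 : α ≠ 0) :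
    IsProbabilityMeasure (renyiMean α P) := by
  refine ⟨?_⟩
  rw [renyiMean, Measure.smul_apply, smul_eq_mul]
  exact ENNReal.inv_mul_cancel (meanMeasure_univ_ne_zero hP h0) (meanMeasure_univ_ne_top hP h0)

lemma renyiMean_absolutelyContinuous (α : ℝ≥0∞) (P : ProbabilityMeasure Y →₀ ℝ) :
    renyiMean α P ≪ mixture P :=
  Measure.AbsolutelyContinuous.trans Measure.smul_absolutelyContinuous
    (withDensity_absolutelyContinuous _ _)

lemma renyiMean_rnDeriv (α : ℝ≥0∞) (P : ProbabilityMeasure Y →₀ ℝ) :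
    (renyiMean α P).rnDeriv (mixture P) =ᵐ[mixture P]
      fun y => (meanMeasure α P Set.univ)⁻¹ * meanDensity α P y := by
  have h1 : renyiMean α P = (mixture P).withDensity
      fun y => (meanMeasure α P Set.univ)⁻¹ * meanDensity α P y := by
    rw [renyiMean]
    nth_rw 2 [meanMeasure]
    rw [← withDensity_smul _ (measurable_meanDensity α P)]
    rfl
  rw [h1]
  exact Measure.rnDeriv_withDensity _ ((measurable_meanDensity α P).const_mul _)

end Mean

end Renyi

namespace Renyi

/-! ### Sibson's identity for orders other than one. -/

section Sibson

variable {Y : Type*} [MeasurableSpace Y] {P : ProbabilityMeasure Y →₀ ℝ} {α : ℝ≥0∞}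

/-- The density relative to the mixture is known only almost everywhere for the mixture. Where the
mixture has zero density relative to ν, both sides vanish. -/
lemma renyiMean_rnDeriv_mul_mixture (hP : IsPrior P) (h0 : α ≠ 0) (ν : Measure Y)
    [SigmaFinite ν] :
    (renyiMean α P).rnDeriv ν =ᵐ[ν] fun y => (meanMeasure α P Set.univ)⁻¹ *
      (meanDensity α P y * (mixture P).rnDeriv ν y) := by
  have := isProbabilityMeasure_renyiMean (α := α) hP h0
  filter_upwards [Measure.rnDeriv_mul_rnDeriv (κ := ν) (renyiMean_absolutelyContinuous α P),
    Measure.ae_rnDeriv_ne_zero_imp_of_ae (ν := ν) (renyiMean_rnDeriv α P)] with y h1 h2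
  rw [← h1, Pi.mul_apply]
  by_cases hr : (mixture P).rnDeriv ν y = 0
  · simp [hr]
  · rw [h2 hr, mul_assoc]

lemma ae_rnDeriv_mul_mixture (hP : IsPrior P) (ν : Measure Y) [SigmaFinite ν] :
    ∀ᵐ y ∂ν, ∀ w ∈ P.support, (w : Measure Y).rnDeriv (mixture P) y * (mixture P).rnDeriv ν y
      = (w : Measure Y).rnDeriv ν y :=
  (Finset.eventually_all _).2 fun _ hw =>
    Measure.rnDeriv_mul_rnDeriv (absolutelyContinuous_mixture hP hw)

/-- Sibson's identity in multiplicative form: by definition of the mean density, the P-average of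
the a-th powers of the densities is the a-th power of the mean density, that is, of the total mass
times the density of the Rényi mean. -/
lemma powInt_joint (hP : IsPrior P) (h0 : α ≠ 0) (ht : α ≠ ∞) (Q : ProbabilityMeasure Y) :
    powInt α.toReal (joint P) ((priorMeasure P).prod (Q : Measure Y))
      = (meanMeasure α P Set.univ) ^ α.toReal * powInt α.toReal (renyiMean α P) Q := by
  have ha : 0 < α.toReal := ENNReal.toReal_pos h0 ht
  have := isProbabilityMeasure_renyiMean (α := α) hP h0
  have hQ : (Q : Measure Y) ≪ mixture P + Q := Measure.AbsolutelyContinuous.rfl.add_right' _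
  have hmix : mixture P ≪ mixture P + Q := Measure.AbsolutelyContinuous.rfl.add_right _
  have hc0 := meanMeasure_univ_ne_zero (α := α) hP h0
  have hct := meanMeasure_univ_ne_top (α := α) hP h0
  rw [powInt, lintegral_joint_eq_sum (measurable_rpow_mul _) (rpow_homogeneous ha)
    (fun w hw => ac_mixture_add hP hw Q) Q hQ,
    powInt_eq_lintegral ha ((renyiMean_absolutelyContinuous α P).trans hmix) hQ]
  have hm : ∀ μ : Measure Y, Measurable fun y => μ.rnDeriv (mixture P + Q) y ^ α.toReal *
      (Q : Measure Y).rnDeriv (mixture P + Q) y ^ (1 - α.toReal) := fun μ =>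
    ((Measure.measurable_rnDeriv _ _).pow_const _).mul
      ((Measure.measurable_rnDeriv _ _).pow_const _)
  rw [← lintegral_const_mul _ (hm _)]
  simp_rw [← lintegral_const_mul _ (hm _)]
  rw [← lintegral_finsetSum _ fun (w : ProbabilityMeasure Y) _ => (hm (w : Measure Y)).const_mul _]
  refine lintegral_congr_ae ?_
  filter_upwards [renyiMean_rnDeriv_mul_mixture (α := α) hP h0 (mixture P + Q),
    ae_rnDeriv_mul_mixture hP (mixture P + Q)] with y h1 h2
  rw [h1, ENNReal.mul_rpow_of_nonneg _ _ ha.le, ENNReal.mul_rpow_of_nonneg _ _ ha.le,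
    meanDensity_rpow h0 ht, ← mul_assoc, ← mul_assoc, ← ENNReal.mul_rpow_of_nonneg _ _ ha.le,
    ENNReal.mul_inv_cancel hc0 hct, ENNReal.one_rpow, one_mul, Finset.sum_mul, Finset.sum_mul]
  refine Finset.sum_congr rfl fun w hw => ?_
  rw [← h2 w hw, ENNReal.mul_rpow_of_nonneg _ _ ha.le]
  ring

lemma coe_mul_log_mul {r b : ℝ} {c X : ℝ≥0∞} (hc0 : c ≠ 0) (hct : c ≠ ∞) :
    (r : EReal) * ENNReal.log (c ^ b * X)
      = ((b * r : ℝ) : EReal) * ENNReal.log c + (r : EReal) * ENNReal.log X := by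
  have h0 : c ^ b ≠ 0 := (ENNReal.rpow_pos (pos_iff_ne_zero.2 hc0) hct).ne'
  have ht : c ^ b ≠ ∞ := by
    rw [← ENNReal.coe_toNNReal hct, ← ENNReal.coe_rpow_of_ne_zero
      (ENNReal.toNNReal_ne_zero.2 ⟨hc0, hct⟩)]
    exact ENNReal.coe_ne_top
  rw [← ENNReal.log_rpow, ENNReal.mul_rpow_eq_ite, if_neg (by simp [h0, ht]),
    ENNReal.log_mul_add, ← ENNReal.rpow_mul, ENNReal.log_rpow, ENNReal.log_rpow]

/-- Sibson's identity for orders other than `1` and `∞`. -/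
lemma jointDivergence_eq_of_ne (hP : IsPrior P) (h0 : α ≠ 0) (h1 : α ≠ 1) (ht : α ≠ ∞)
    (Q : ProbabilityMeasure Y) :
    jointDivergence α P Q = information α P + divergence α (renyiMean α P) Q := by
  rw [jointDivergence, divergence_eq_powInt h0 h1 ht, divergence_eq_powInt h0 h1 ht,
    powInt_joint hP h0 ht, coe_mul_log_mul (meanMeasure_univ_ne_zero hP h0)
      (meanMeasure_univ_ne_top hP h0), information, if_neg h0, if_neg h1, if_neg ht, div_eq_mul_inv]

/-- Rectangles {w} × E isolate one fibre, and the positive finite weight P(w) cancels; so for order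
∞ only the support of the prior matters. -/
lemma joint_le_smul_prod_iff (hP : IsPrior P) (K : ℝ≥0∞) (Q : ProbabilityMeasure Y) :
    joint P ≤ K • (priorMeasure P).prod (Q : Measure Y) ↔
      ∀ w ∈ P.support, (w : Measure Y) ≤ K • (Q : Measure Y) := by
  have hj : ∀ s : Set (Support P × Y), MeasurableSet s → joint P s =
      ∑ w : Support P, ENNReal.ofReal (P w.1) * (w.1 : Measure Y) (Prod.mk w ⁻¹' s) := by
    intro s hs
    rw [joint_apply hs, priorMeasure, lintegral_finsetSum_measure]
    refine Finset.sum_congr rfl fun w _ => ?_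
    rw [lintegral_smul_measure, lintegral_dirac, smul_eq_mul]
  have hq : ∀ s : Set (Support P × Y), MeasurableSet s →
      (priorMeasure P).prod (Q : Measure Y) s =
      ∑ w : Support P, ENNReal.ofReal (P w.1) * (Q : Measure Y) (Prod.mk w ⁻¹' s) := by
    intro s hs
    rw [Measure.prod_apply hs, priorMeasure, lintegral_finsetSum_measure]
    refine Finset.sum_congr rfl fun w _ => ?_
    rw [lintegral_smul_measure, lintegral_dirac, smul_eq_mul]
  constructor
  · intro h w hw
    refine Measure.le_iff.2 fun E hE => ?_
    let v : Support P := ⟨w, hw⟩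
    have hs : MeasurableSet (({v} : Set (Support P)) ×ˢ E) := (measurableSet_singleton v).prod hE
    have hpre : ∀ u : Support P, u ≠ v → Prod.mk u ⁻¹' (({v} : Set (Support P)) ×ˢ E) = ∅ := by
      intro u hu
      ext y
      simp [hu]
    have hprev : Prod.mk v ⁻¹' (({v} : Set (Support P)) ×ˢ E) = E := by
      ext y
      simp
    have h1 := Measure.le_iff.1 h _ hs
    rw [Measure.smul_apply, hj _ hs, hq _ hs,
      Finset.sum_eq_single v (fun u _ hu => by simp [hpre u hu]) (by simp),
      Finset.sum_eq_single v (fun u _ hu => by simp [hpre u hu]) (by simp), hprev, smul_eq_mul,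
      mul_left_comm] at h1
    rw [Measure.smul_apply, smul_eq_mul]
    exact (ENNReal.mul_le_mul_iff_right (hP.ofReal_ne_zero hw) ENNReal.ofReal_ne_top).1 h1
  · intro h
    refine Measure.le_iff.2 fun s hs => ?_
    rw [Measure.smul_apply, smul_eq_mul, hj s hs, hq s hs, Finset.mul_sum]
    refine Finset.sum_le_sum fun w _ => ?_
    rw [mul_left_comm]
    gcongr
    exact Measure.le_iff'.1 (h w.1 w.2) _

/-- Finitely many densities lie below K times that of Q exactly when their maximum does, and the
maximum is the unnormalized mean density of order ∞. -/
lemma renyiMean_top_le_iff (hP : IsPrior P) (K : ℝ≥0∞) (Q : ProbabilityMeasure Y) :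
    (∀ w ∈ P.support, (w : Measure Y) ≤ K • (Q : Measure Y)) ↔
      renyiMean ∞ P ≤ ((meanMeasure ∞ P Set.univ)⁻¹ * K) • (Q : Measure Y) := by
  have ht0 : (∞ : ℝ≥0∞) ≠ 0 := ENNReal.top_ne_zero
  have := isProbabilityMeasure_renyiMean (α := ∞) hP ht0
  have hc0 := meanMeasure_univ_ne_zero (α := ∞) hP ht0
  have hct := meanMeasure_univ_ne_top (α := ∞) hP ht0
  constructor
  · intro h
    have hQ : (Q : Measure Y) ≪ mixture P + Q := Measure.AbsolutelyContinuous.rfl.add_right' _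
    have hmix : mixture P ≪ mixture P + Q := Measure.AbsolutelyContinuous.rfl.add_right _
    have hmQ := Measure.measurable_rnDeriv (Q : Measure Y) (mixture P + Q)
    have hle : ∀ᵐ y ∂(mixture P + (Q : Measure Y)), ∀ w ∈ P.support,
        (w : Measure Y).rnDeriv (mixture P + Q) y ≤ K * (Q : Measure Y).rnDeriv (mixture P + Q) y := by
      refine (Finset.eventually_all _).2 fun w hw => ?_
      refine ae_le_of_forall_setLIntegral_le_of_sigmaFinite (Measure.measurable_rnDeriv _ _)
        fun E hE _ => ?_
      rw [lintegral_const_mul _ hmQ, Measure.setLIntegral_rnDeriv' (ac_mixture_add hP hw Q) hE,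
        Measure.setLIntegral_rnDeriv' hQ hE]
      exact Measure.le_iff.1 (h w hw) E hE
    refine Measure.le_iff.2 fun E hE => ?_
    rw [Measure.smul_apply, smul_eq_mul, ← Measure.setLIntegral_rnDeriv' hQ hE,
      ← Measure.setLIntegral_rnDeriv' ((renyiMean_absolutelyContinuous ∞ P).trans hmix) hE,
      ← lintegral_const_mul _ hmQ]
    refine lintegral_mono_ae (ae_restrict_of_ae ?_)
    filter_upwards [renyiMean_rnDeriv_mul_mixture (α := ∞) hP ht0 (mixture P + Q),
      ae_rnDeriv_mul_mixture hP (mixture P + Q), hle] with y h1 h2 h3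
    rw [h1, mul_assoc]
    refine mul_le_mul' le_rfl ?_
    rw [meanDensity, if_neg ht0, if_pos rfl, ENNReal.iSup_mul]
    refine iSup_le fun w => ?_
    rw [ENNReal.iSup_mul]
    refine iSup_le fun hw => ?_
    rw [h2 w hw]
    exact h3 w hw
  · intro h w hw
    refine Measure.le_iff.2 fun E hE => ?_
    have h1 := Measure.le_iff.1 h E hE
    rw [renyiMean, Measure.smul_apply, Measure.smul_apply, smul_eq_mul, smul_eq_mul, mul_assoc,
      ENNReal.mul_le_mul_iff_right (ENNReal.inv_ne_zero.2 hct) (ENNReal.inv_ne_top.2 hc0)] at h1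
    rw [Measure.smul_apply, smul_eq_mul]
    refine le_trans ?_ h1
    rw [meanMeasure, withDensity_apply _ hE,
      ← Measure.setLIntegral_rnDeriv' (absolutelyContinuous_mixture hP hw) hE]
    refine lintegral_mono fun y => ?_
    rw [meanDensity, if_neg ht0, if_pos rfl]
    exact le_iSup₂ (f := fun (w : ProbabilityMeasure Y) (_ : w ∈ P.support) =>
      (w : Measure Y).rnDeriv (mixture P) y) w hw

/-- Sibson's identity for order ∞ is proved by comparing real sublevel sets. -/
lemma eq_of_forall_le_coe_iff {x y : EReal} (h : ∀ c : ℝ, x ≤ c ↔ y ≤ c) : x = y :=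
  le_antisymm (EReal.le_of_forall_lt_iff_le.1 fun c hc => (h c).2 hc.le)
    (EReal.le_of_forall_lt_iff_le.1 fun c hc => (h c).1 hc.le)

lemma coe_add_le_coe_iff {r c : ℝ} {x : EReal} : (r : EReal) + x ≤ c ↔ x ≤ ((c - r : ℝ) : EReal) := by
  induction x with
  | bot => simp
  | top => 
    simp only [EReal.coe_add_top, top_le_iff, EReal.coe_ne_top]
  | coe x => norm_cast; constructor <;> intro h <;> linarith

lemma log_eq_coe {c : ℝ≥0∞} (h0 : c ≠ 0) (ht : c ≠ ∞) :
    ENNReal.log c = (Real.log c.toReal : EReal) := ENNReal.log_pos_real h0 ht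

/-- Sibson's identity for order `∞`. -/
lemma jointDivergence_top (hP : IsPrior P) (Q : ProbabilityMeasure Y) :
    jointDivergence ∞ P Q = information ∞ P + divergence ∞ (renyiMean ∞ P) Q := by
  have ht0 : (∞ : ℝ≥0∞) ≠ 0 := ENNReal.top_ne_zero
  have := isProbabilityMeasure_renyiMean (α := ∞) hP ht0
  have hc0 := meanMeasure_univ_ne_zero (α := ∞) hP ht0
  have hct := meanMeasure_univ_ne_top (α := ∞) hP ht0
  refine eq_of_forall_le_coe_iff fun c => ?_
  rw [jointDivergence, divergence_top_le_iff, joint_le_smul_prod_iff hP, renyiMean_top_le_iff hP,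
    information, if_neg ht0, if_neg ENNReal.top_ne_one, if_pos rfl, log_eq_coe hc0 hct,
    coe_add_le_coe_iff, divergence_top_le_iff]
  have : (meanMeasure ∞ P Set.univ)⁻¹ * ENNReal.ofReal (Real.exp c)
      = ENNReal.ofReal (Real.exp (c - Real.log (meanMeasure ∞ P Set.univ).toReal)) := by
    rw [Real.exp_sub, Real.exp_log (ENNReal.toReal_pos hc0 hct),
      ENNReal.ofReal_div_of_pos (ENNReal.toReal_pos hc0 hct), ENNReal.ofReal_toReal hct, mul_comm,
      div_eq_mul_inv]
  rw [this]

end Sibson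

end Renyi

namespace Renyi

/-! ### Sibson's identity for order one, by the compensation identity. -/

section OrderOne

lemma persp_one_eq {w q : ℝ≥0∞} (hq0 : q ≠ 0) (hq : q ≠ ∞) :
    persp 1 w q = ENNReal.ofReal
      (w.toReal * Real.log (w.toReal / q.toReal) + q.toReal - w.toReal) := by
  have hq' : 0 < q.toReal := ENNReal.toReal_pos hq0 hq
  rw [persp, if_neg hq0, gen_eq_klFun]
  nth_rw 1 [← ENNReal.ofReal_toReal hq]
  rw [← ENNReal.ofReal_mul hq'.le, ENNReal.toReal_div, InformationTheory.klFun_apply]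
  congr 1
  field_simp

/-- The compensation identity for the relative entropy, pointwise. -/
lemma sum_persp_one {ι : Type*} (s : Finset ι) {p : ι → ℝ} (hp : ∀ i ∈ s, 0 < p i)
    (hsum : ∑ i ∈ s, p i = 1) {x : ι → ℝ≥0∞} (hx : ∀ i ∈ s, x i ≠ ∞) {q : ℝ≥0∞} (hq : q ≠ ∞) :
    ∑ i ∈ s, ENNReal.ofReal (p i) * persp 1 (x i) q
      = ∑ i ∈ s, ENNReal.ofReal (p i) * persp 1 (x i) (∑ j ∈ s, ENNReal.ofReal (p j) * x j)
        + persp 1 (∑ j ∈ s, ENNReal.ofReal (p j) * x j) q := by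
  have hpE : ∀ i ∈ s, ENNReal.ofReal (p i) ≠ 0 := fun i hi => (ENNReal.ofReal_pos.2 (hp i hi)).ne'
  have hsumE : ∑ i ∈ s, ENNReal.ofReal (p i) = 1 := by
    rw [← ENNReal.ofReal_sum_of_nonneg fun i hi => (hp i hi).le, hsum, ENNReal.ofReal_one]
  set m := ∑ j ∈ s, ENNReal.ofReal (p j) * x j with hm
  have hmt : m ≠ ∞ := ENNReal.sum_ne_top.2 fun i hi => ENNReal.mul_ne_top ENNReal.ofReal_ne_top
    (hx i hi)
  -- The logarithmic computation needs m and q positive. If m = 0, every x i is 0; if m > 0 = q,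
  -- both sides are infinite.
  by_cases hm0 : m = 0
  · have hx0 : ∀ i ∈ s, x i = 0 := fun i hi =>
      (mul_eq_zero.1 (Finset.sum_eq_zero_iff.1 hm0 i hi)).resolve_left (hpE i hi)
    rw [hm0, Finset.sum_congr rfl fun i hi => by rw [hx0 i hi], ← Finset.sum_mul, hsumE, one_mul,
      Finset.sum_eq_zero fun i hi => by rw [hx0 i hi, persp_zero_zero, mul_zero], zero_add]
  have htop : ∀ {v : ℝ≥0∞}, v ≠ 0 → persp 1 v 0 = ∞ := fun {v} hv => by
    rw [persp, if_pos rfl, genSlope, if_neg (lt_irrefl _), ENNReal.top_mul hv]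
  by_cases hq0 : q = 0
  · subst hq0
    obtain ⟨i, hi, hxi⟩ : ∃ i ∈ s, x i ≠ 0 := by
      by_contra! h
      exact hm0 (Finset.sum_eq_zero fun i hi => by rw [h i hi, mul_zero])
    rw [htop hm0, add_top]
    exact ENNReal.sum_eq_top.2 ⟨i, hi, by rw [htop hxi, ENNReal.mul_top (hpE i hi)]⟩
  have hqr : 0 < q.toReal := ENNReal.toReal_pos hq0 hq
  have hmr : 0 < m.toReal := ENNReal.toReal_pos hm0 hmt
  have hmeq : m.toReal = ∑ i ∈ s, p i * (x i).toReal := by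
    rw [hm, ENNReal.toReal_sum fun i hi => ENNReal.mul_ne_top ENNReal.ofReal_ne_top (hx i hi)]
    exact Finset.sum_congr rfl fun i hi => by
      rw [ENNReal.toReal_mul, ENNReal.toReal_ofReal (hp i hi).le]
  have hnn : ∀ {v u : ℝ}, 0 ≤ v → 0 < u → 0 ≤ v * Real.log (v / u) + u - v := by
    intro v u hv hu
    have h1 := mul_nonneg hu.le (InformationTheory.klFun_nonneg (div_nonneg hv hu.le))
    rw [InformationTheory.klFun_apply] at h1
    have h2 : u * (v / u * Real.log (v / u) + 1 - v / u) = v * Real.log (v / u) + u - v := by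
      field_simp
    linarith
  have hterm : ∀ {u : ℝ≥0∞}, u ≠ 0 → u ≠ ∞ → ∑ i ∈ s, ENNReal.ofReal (p i) * persp 1 (x i) u
      = ENNReal.ofReal (∑ i ∈ s, p i * ((x i).toReal * Real.log ((x i).toReal / u.toReal)
        + u.toReal - (x i).toReal)) := by
    intro u hu0 hu
    have hur : 0 < u.toReal := ENNReal.toReal_pos hu0 hu
    rw [ENNReal.ofReal_sum_of_nonneg fun i hi => mul_nonneg (hp i hi).le
      (hnn ENNReal.toReal_nonneg hur)]
    exact Finset.sum_congr rfl fun i hi => by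
      rw [persp_one_eq hu0 hu, ENNReal.ofReal_mul (hp i hi).le]
  rw [hterm hq0 hq, hterm hm0 hmt, persp_one_eq hq0 hq, ← ENNReal.ofReal_add
    (Finset.sum_nonneg fun i hi => mul_nonneg (hp i hi).le (hnn ENNReal.toReal_nonneg hmr))
    (hnn hmr.le hqr)]
  congr 1
  -- The split log (x/q) = log (x/m) + log (m/q). For x = 0 its factor kills all logarithms.
  have hlog : ∀ i ∈ s, p i * ((x i).toReal * Real.log ((x i).toReal / q.toReal)
        + q.toReal - (x i).toReal) = p i * ((x i).toReal * Real.log ((x i).toReal / m.toReal)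
        + m.toReal - (x i).toReal) + (p i * (x i).toReal) * Real.log (m.toReal / q.toReal)
        + p i * (q.toReal - m.toReal) := by
    intro i _
    rcases eq_or_lt_of_le (ENNReal.toReal_nonneg (a := x i)) with h | h
    · rw [← h]; ring
    · rw [Real.log_div h.ne' hqr.ne', Real.log_div h.ne' hmr.ne', Real.log_div hmr.ne' hqr.ne']
      ring
  rw [Finset.sum_congr rfl hlog, Finset.sum_add_distrib, Finset.sum_add_distrib, ← Finset.sum_mul,
    ← Finset.sum_mul, ← hmeq, hsum]
  ring

variable {Y : Type*} [MeasurableSpace Y] {P : ProbabilityMeasure Y →₀ ℝ}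

lemma withDensity_sum_rnDeriv {ν : Measure Y} [SigmaFinite ν]
    (hν : ∀ w ∈ P.support, (w : Measure Y) ≪ ν) :
    ν.withDensity (fun y => ∑ w ∈ P.support, ENNReal.ofReal (P w) * (w : Measure Y).rnDeriv ν y)
      = mixture P := by
  refine Measure.ext fun E hE => ?_
  rw [withDensity_apply _ hE, mixture_apply, lintegral_finsetSum _
    fun (w : ProbabilityMeasure Y) _ => (Measure.measurable_rnDeriv (w : Measure Y) ν).const_mul _]
  refine Finset.sum_congr rfl fun w hw => ?_
  rw [lintegral_const_mul _ (Measure.measurable_rnDeriv _ _),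
    Measure.setLIntegral_rnDeriv' (hν w hw) hE]

lemma mixture_rnDeriv {ν : Measure Y} [SigmaFinite ν]
    (hν : ∀ w ∈ P.support, (w : Measure Y) ≪ ν) :
    (mixture P).rnDeriv ν =ᵐ[ν]
      fun y => ∑ w ∈ P.support, ENNReal.ofReal (P w) * (w : Measure Y).rnDeriv ν y := by
  rw [← withDensity_sum_rnDeriv hν]
  exact Measure.rnDeriv_withDensity _ (Finset.measurable_fun_sum _
    fun (w : ProbabilityMeasure Y) _ => (Measure.measurable_rnDeriv (w : Measure Y) ν).const_mul _)

lemma meanMeasure_one (hP : IsPrior P) : meanMeasure 1 P = mixture P := by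
  refine Eq.trans ?_
    (withDensity_sum_rnDeriv (P := P) fun w hw => absolutelyContinuous_mixture hP hw)
  rw [meanMeasure]
  congr 1
  ext y
  simp [meanDensity]

lemma renyiMean_one (hP : IsPrior P) : renyiMean 1 P = mixture P := by
  have := isProbabilityMeasure_mixture hP
  rw [renyiMean, meanMeasure_one hP, measure_univ, inv_one, one_smul]

lemma measurable_persp_rnDeriv (a : ℝ) (W Q ν : Measure Y) :
    Measurable fun y => persp a (W.rnDeriv ν y) (Q.rnDeriv ν y) :=
  (measurable_persp a).comp ((Measure.measurable_rnDeriv _ _).prodMk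
    (Measure.measurable_rnDeriv _ _))

/-- The pointwise compensation identity integrated against a common reference measure, the average
of the densities being the density of the mixture. -/
lemma sum_fdiv_one (hP : IsPrior P) (Q : ProbabilityMeasure Y) :
    ∑ w ∈ P.support, ENNReal.ofReal (P w) * fdiv 1 (w : Measure Y) (Q : Measure Y)
      = ∑ w ∈ P.support, ENNReal.ofReal (P w) * fdiv 1 (w : Measure Y) (mixture P)
        + fdiv 1 (mixture P) (Q : Measure Y) := by
  have hQ : (Q : Measure Y) ≪ mixture P + Q := Measure.AbsolutelyContinuous.rfl.add_right' _
  have hmix : mixture P ≪ mixture P + Q := Measure.AbsolutelyContinuous.rfl.add_right _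
  have hw : ∀ w ∈ P.support, (w : Measure Y) ≪ mixture P + Q := fun w hw => ac_mixture_add hP hw Q
  have key : ∀ (R : Measure Y) [IsFiniteMeasure R], R ≪ mixture P + Q →
      ∑ w ∈ P.support, ENNReal.ofReal (P w) * fdiv 1 (w : Measure Y) R
      = ∫⁻ y, ∑ w ∈ P.support, ENNReal.ofReal (P w) *
        persp 1 ((w : Measure Y).rnDeriv (mixture P + Q) y) (R.rnDeriv (mixture P + Q) y)
        ∂(mixture P + (Q : Measure Y)) := by
    intro R _ hR
    rw [lintegral_finsetSum _ fun (w : ProbabilityMeasure Y) _ =>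
      (measurable_persp_rnDeriv 1 (w : Measure Y) R (mixture P + Q)).const_mul _]
    refine Finset.sum_congr rfl fun w h => ?_
    rw [lintegral_const_mul _ (measurable_persp_rnDeriv _ _ _ _), fdiv_eq_lintegral 1 (hw w h) hR]
  rw [key Q hQ, key (mixture P) hmix, fdiv_eq_lintegral 1 hmix hQ,
    ← lintegral_add_right _ (measurable_persp_rnDeriv _ _ _ _)]
  refine lintegral_congr_ae ?_
  have hfin : ∀ᵐ y ∂(mixture P + (Q : Measure Y)), ∀ w ∈ P.support,
      (w : Measure Y).rnDeriv (mixture P + Q) y < ∞ :=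
    (Finset.eventually_all _).2 fun w _ => Measure.rnDeriv_lt_top _ _
  filter_upwards [mixture_rnDeriv hw, hfin,
    Measure.rnDeriv_lt_top (Q : Measure Y) (mixture P + Q)] with y h1 h2 h3
  rw [h1]
  exact sum_persp_one P.support (fun w hw => hP.pos hw) hP.2 (fun w hw => (h2 w hw).ne) h3.ne

lemma lintegral_sum_klFun (hP : IsPrior P) :
    ∑ w ∈ P.support, ENNReal.ofReal (P w) * fdiv 1 (w : Measure Y) (mixture P)
      = ∫⁻ y, ENNReal.ofReal (∑ w ∈ P.support, P w *
          InformationTheory.klFun ((w : Measure Y).rnDeriv (mixture P) y).toReal) ∂(mixture P) := by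
  have hnn : ∀ (w : ProbabilityMeasure Y) (y : Y), 0 ≤ InformationTheory.klFun
      ((w : Measure Y).rnDeriv (mixture P) y).toReal := fun w y =>
    InformationTheory.klFun_nonneg ENNReal.toReal_nonneg
  have hm : ∀ w : ProbabilityMeasure Y, Measurable fun y => ENNReal.ofReal
      (InformationTheory.klFun ((w : Measure Y).rnDeriv (mixture P) y).toReal) := fun w =>
    (InformationTheory.measurable_klFun.comp
      (Measure.measurable_rnDeriv (w : Measure Y) (mixture P)).ennreal_toReal).ennreal_ofReal
  simp_rw [ENNReal.ofReal_sum_of_nonneg fun w _ => mul_nonneg (hP.1 w) (hnn w _),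
    ENNReal.ofReal_mul (hP.1 _)]
  rw [lintegral_finsetSum _ fun (w : ProbabilityMeasure Y) _ => (hm w).const_mul _]
  refine Finset.sum_congr rfl fun w hw => ?_
  rw [lintegral_const_mul _ (hm w), ← klDiv_eq_fdiv,
    InformationTheory.klDiv_eq_lintegral_klFun_of_ac (absolutelyContinuous_mixture hP hw)]

lemma ae_sum_mul_rnDeriv (hP : IsPrior P) : ∀ᵐ y ∂(mixture P),
    (∀ w ∈ P.support, (w : Measure Y).rnDeriv (mixture P) y ≠ ∞) ∧
    ∑ w ∈ P.support, P w * ((w : Measure Y).rnDeriv (mixture P) y).toReal = 1 := by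
  have hfin : ∀ᵐ y ∂(mixture P), ∀ w ∈ P.support, (w : Measure Y).rnDeriv (mixture P) y < ∞ :=
    (Finset.eventually_all _).2 fun w _ => Measure.rnDeriv_lt_top _ _
  filter_upwards [mixture_rnDeriv fun w hw => absolutelyContinuous_mixture hP hw,
    Measure.rnDeriv_self (mixture P), hfin] with y h1 h2 h3
  refine ⟨fun w hw => (h3 w hw).ne, ?_⟩
  have h4 := congrArg ENNReal.toReal (h1.symm.trans h2)
  rw [ENNReal.toReal_sum fun w hw => ENNReal.mul_ne_top ENNReal.ofReal_ne_top (h3 w hw).ne,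
    ENNReal.toReal_one] at h4
  rw [← h4]
  exact Finset.sum_congr rfl fun w _ => by rw [ENNReal.toReal_mul, ENNReal.toReal_ofReal (hP.1 w)]

/-- The posteriors sum to one, so each density d relative to the mixture is at most 1 / P(w). Then d
ln d + 1 - d ≤ d² + 1 bounds the integrand by a constant. -/
lemma sum_fdiv_mixture_ne_top (hP : IsPrior P) :
    ∑ w ∈ P.support, ENNReal.ofReal (P w) * fdiv 1 (w : Measure Y) (mixture P) ≠ ∞ := by
  have := isProbabilityMeasure_mixture hP
  rw [lintegral_sum_klFun hP]
  refine ((lintegral_mono_ae (g := fun _ => ENNReal.ofReal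
    (∑ w ∈ P.support, P w * ((P w)⁻¹ * (P w)⁻¹ + 1))) ?_).trans_lt ?_).ne
  · filter_upwards [ae_sum_mul_rnDeriv hP] with y hy
    refine ENNReal.ofReal_le_ofReal (Finset.sum_le_sum fun w hw => ?_)
    refine mul_le_mul_of_nonneg_left ?_ (hP.1 w)
    set d := ((w : Measure Y).rnDeriv (mixture P) y).toReal
    have hd0 : 0 ≤ d := ENNReal.toReal_nonneg
    have hpw := hP.pos hw
    have hd : d ≤ (P w)⁻¹ := by
      rw [← one_div, le_div_iff₀ hpw, mul_comm, ← hy.2]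
      exact Finset.single_le_sum (f := fun w : ProbabilityMeasure Y =>
        P w * ((w : Measure Y).rnDeriv (mixture P) y).toReal)
        (fun v _ => mul_nonneg (hP.1 v) ENNReal.toReal_nonneg) hw
    rw [InformationTheory.klFun_apply]
    have h1 : d * Real.log d ≤ d * d := mul_le_mul_of_nonneg_left (Real.log_le_self hd0) hd0
    have h2 : d * d ≤ (P w)⁻¹ * (P w)⁻¹ := mul_le_mul hd hd hd0 (inv_nonneg.2 hpw.le)
    linarith
  · rw [lintegral_const, measure_univ, mul_one]
    exact ENNReal.ofReal_lt_top

/-- The terms 1 - d in the relative entropy integrand have P-average zero almost everywhere, which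
leaves the posterior form of the information. -/
lemma information_one (hP : IsPrior P) :
    information 1 P = ((∑ w ∈ P.support, ENNReal.ofReal (P w) *
      fdiv 1 (w : Measure Y) (mixture P) : ℝ≥0∞) : EReal) := by
  rw [← ENNReal.ofReal_toReal (sum_fdiv_mixture_ne_top hP), EReal.coe_ennreal_ofReal,
    max_eq_left ENNReal.toReal_nonneg, information, if_neg one_ne_zero, if_pos rfl,
    lintegral_sum_klFun hP, ← integral_eq_lintegral_of_nonneg_ae]
  · congr 1
    refine integral_congr_ae ?_
    filter_upwards [ae_sum_mul_rnDeriv hP] with y hy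
    simp only [posteriorPMF, InformationTheory.klFun_apply]
    have h1 : ∀ w ∈ P.support, P w * (((w : Measure Y).rnDeriv (mixture P) y).toReal *
        Real.log ((w : Measure Y).rnDeriv (mixture P) y).toReal + 1 -
        ((w : Measure Y).rnDeriv (mixture P) y).toReal)
        = P w * ((w : Measure Y).rnDeriv (mixture P) y).toReal * Real.log
          (P w * ((w : Measure Y).rnDeriv (mixture P) y).toReal / P w) + P w -
          P w * ((w : Measure Y).rnDeriv (mixture P) y).toReal := by
      intro w hw
      rw [mul_div_cancel_left₀ _ (hP.pos hw).ne']
      ring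
    rw [Finset.sum_congr rfl h1, Finset.sum_sub_distrib, Finset.sum_add_distrib, hP.2, hy.2]
    ring
  · exact .of_forall fun y => Finset.sum_nonneg fun w _ =>
      mul_nonneg (hP.1 w) (InformationTheory.klFun_nonneg ENNReal.toReal_nonneg)
  · refine (Finset.measurable_fun_sum _ fun (w : ProbabilityMeasure Y) _ =>
      (InformationTheory.measurable_klFun.comp ?_).const_mul _).aestronglyMeasurable
    exact (Measure.measurable_rnDeriv (w : Measure Y) (mixture P)).ennreal_toReal

/-- Sibson's identity for order `1`. -/
lemma jointDivergence_one (hP : IsPrior P) (Q : ProbabilityMeasure Y) :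
    jointDivergence 1 P Q = information 1 P + divergence 1 (renyiMean 1 P) Q := by
  have h1 := isProbabilityMeasure_mixture hP
  have h2 := isProbabilityMeasure_priorMeasure hP
  have h3 := isProbabilityMeasure_joint hP
  rw [renyiMean_one hP, divergence_one_eq, jointDivergence, divergence_one_eq, information_one hP,
    fdiv_joint hP, sum_fdiv_one hP, EReal.coe_ennreal_add]

/-- Sibson's identity. -/
lemma jointDivergence_eq (hP : IsPrior P) {α : ℝ≥0∞} (h0 : α ≠ 0) (Q : ProbabilityMeasure Y) :
    jointDivergence α P Q = information α P + divergence α (renyiMean α P) Q := by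
  by_cases h1 : α = 1
  · subst h1; exact jointDivergence_one hP Q
  by_cases ht : α = ∞
  · subst ht; exact jointDivergence_top hP Q
  exact jointDivergence_eq_of_ne hP h0 h1 ht Q

lemma exists_information_eq_coe (hP : IsPrior P) {α : ℝ≥0∞} (h0 : α ≠ 0) :
    ∃ r : ℝ, information α P = r := by
  have hlog := log_eq_coe (meanMeasure_univ_ne_zero (α := α) hP h0) (meanMeasure_univ_ne_top hP h0)
  by_cases h1 : α = 1
  · subst h1
    exact ⟨_, by rw [information, if_neg one_ne_zero, if_pos rfl]⟩
  by_cases ht : α = ∞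
  · subst ht
    exact ⟨_, by rw [information, if_neg h0, if_neg h1, if_pos rfl, hlog]⟩
  · exact ⟨_, by rw [information, if_neg h0, if_neg h1, if_neg ht, hlog, ← EReal.coe_mul]⟩

end OrderOne

end Renyi

namespace Renyi

/-! ### Mixing an arbitrary prior with an almost optimal one. -/

section Mixing

variable {Y : Type*} [MeasurableSpace Y] {P P' : ProbabilityMeasure Y →₀ ℝ} {α : ℝ≥0∞}

/-- The Rényi mean as a probability measure. -/
noncomputable def meanPM (α : ℝ≥0∞) (h0 : α ≠ 0) (hP : IsPrior P) : ProbabilityMeasure Y :=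
  ⟨renyiMean α P, isProbabilityMeasure_renyiMean hP h0⟩

@[simp] lemma coe_meanPM (h0 : α ≠ 0) (hP : IsPrior P) :
    (meanPM α h0 hP : Measure Y) = renyiMean α P := rfl

lemma jointDivergence_meanPM (h0 : α ≠ 0) (hP : IsPrior P) :
    jointDivergence α P (meanPM α h0 hP) = information α P := by
  have := isProbabilityMeasure_renyiMean (α := α) hP h0
  rw [jointDivergence_eq hP h0, coe_meanPM, divergence_self h0, add_zero]

lemma information_le_jointDivergence (h0 : α ≠ 0) (hP : IsPrior P) (Q : ProbabilityMeasure Y) :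
    information α P ≤ jointDivergence α P Q := by
  have := isProbabilityMeasure_renyiMean (α := α) hP h0
  rw [jointDivergence_eq hP h0]
  exact le_add_of_nonneg_right (divergence_nonneg h0 _ _)

lemma jointDivergence_nonneg (h0 : α ≠ 0) (hP : IsPrior P) (Q : ProbabilityMeasure Y) :
    0 ≤ jointDivergence α P Q := by
  have := isProbabilityMeasure_priorMeasure hP
  have := isProbabilityMeasure_joint hP
  exact divergence_nonneg h0 _ _

lemma information_nonneg (h0 : α ≠ 0) (hP : IsPrior P) : 0 ≤ information α P :=
  jointDivergence_meanPM h0 hP ▸ jointDivergence_nonneg h0 hP _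

lemma jointDivergence_le_iff (h0 : α ≠ 0) (ht : α ≠ ∞) (hP : IsPrior P) (Q : ProbabilityMeasure Y)
    (c : ℝ) : jointDivergence α P Q ≤ c ↔ 0 ≤ c ∧
      ∑ w ∈ P.support, ENNReal.ofReal (P w) * fdiv α.toReal (w : Measure Y) (Q : Measure Y)
        ≤ ENNReal.ofReal (fdivOf α.toReal c) := by
  have := isProbabilityMeasure_priorMeasure hP
  have := isProbabilityMeasure_joint hP
  rw [jointDivergence, divergence_le_iff h0 ht, fdiv_joint hP]

lemma jointDivergence_top_le_iff (hP : IsPrior P) (Q : ProbabilityMeasure Y) (c : ℝ) :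
    jointDivergence ∞ P Q ≤ c ↔
      ∀ w ∈ P.support, (w : Measure Y) ≤ ENNReal.ofReal (Real.exp c) • (Q : Measure Y) := by
  rw [jointDivergence, divergence_top_le_iff, joint_le_smul_prod_iff hP]

/-- The support of the combination depends on s and t, so all sums are extended by zero to the union
of the two supports. -/
lemma sum_mul_convex_combination {s t : ℝ} (hs : 0 ≤ s) (ht : 0 ≤ t) (hP : IsPrior P)
    (hP' : IsPrior P') (g : ProbabilityMeasure Y → ℝ≥0∞) :
    ∑ w ∈ (s • P + t • P').support, ENNReal.ofReal ((s • P + t • P') w) * g w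
      = ENNReal.ofReal s * ∑ w ∈ P.support, ENNReal.ofReal (P w) * g w
        + ENNReal.ofReal t * ∑ w ∈ P'.support, ENNReal.ofReal (P' w) * g w := by
  classical
  have hsub : ∀ (R : ProbabilityMeasure Y →₀ ℝ) (S : Finset (ProbabilityMeasure Y)),
      R.support ⊆ S → ∑ w ∈ R.support, ENNReal.ofReal (R w) * g w
        = ∑ w ∈ S, ENNReal.ofReal (R w) * g w := by
    intro R S h
    refine Finset.sum_subset h fun w _ hw => ?_
    rw [Finsupp.notMem_support_iff.1 hw, ENNReal.ofReal_zero, zero_mul]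
  rw [hsub _ (P.support ∪ P'.support) (Finsupp.support_add.trans
      (Finset.union_subset_union Finsupp.support_smul Finsupp.support_smul)),
    hsub P _ Finset.subset_union_left, hsub P' _ Finset.subset_union_right, Finset.mul_sum,
    Finset.mul_sum, ← Finset.sum_add_distrib]
  refine Finset.sum_congr rfl fun w _ => ?_
  rw [Finsupp.add_apply, Finsupp.smul_apply, Finsupp.smul_apply, smul_eq_mul, smul_eq_mul,
    ENNReal.ofReal_add (mul_nonneg hs (hP.1 w)) (mul_nonneg ht (hP'.1 w)), ENNReal.ofReal_mul hs,
    ENNReal.ofReal_mul ht]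
  ring

/-- For priors in a convex set, one of which almost attains the largest information `C`, some
mixture has a Rényi mean with respect to which neither prior has a divergence much above `C`. -/
lemma exists_mixture_jointDivergence_le (h0 : α ≠ 0) {𝒜 : Set (ProbabilityMeasure Y →₀ ℝ)}
    (h𝒜 : ∀ P ∈ 𝒜, IsPrior P) (hconv : Convex ℝ 𝒜) {C : ℝ} (hC0 : 0 ≤ C)
    (hC : ∀ P ∈ 𝒜, information α P ≤ C) {ε : ℝ} (hε : 0 < ε) :
    ∃ δ : ℝ, 0 < δ ∧ ∀ P ∈ 𝒜, ∀ P' ∈ 𝒜, ((C - δ : ℝ) : EReal) < information α P' →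
      ∃ R : ProbabilityMeasure Y, jointDivergence α P R ≤ ((C + ε : ℝ) : EReal) ∧
        jointDivergence α P' R ≤ ((C + ε : ℝ) : EReal) := by
  by_cases ht : α = ∞
  · subst ht
    -- Any δ works for order ∞: the midpoint's support contains both supports, and the bound for its
    -- own mean passes to each member.
    refine ⟨1, one_pos, fun P hP P' hP' _ => ?_⟩
    have hR : (1 / 2 : ℝ) • P + (1 / 2 : ℝ) • P' ∈ 𝒜 :=
      hconv hP hP' (by norm_num) (by norm_num) (by norm_num)
    have hpos : ∀ w, 0 < P w ∨ 0 < P' w → w ∈ ((1 / 2 : ℝ) • P + (1 / 2 : ℝ) • P').support := by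
      intro w hw
      rw [Finsupp.mem_support_iff, Finsupp.add_apply, Finsupp.smul_apply, Finsupp.smul_apply,
        smul_eq_mul, smul_eq_mul]
      have h1 := (h𝒜 P hP).1 w
      have h2 := (h𝒜 P' hP').1 w
      rcases hw with h | h <;> exact ne_of_gt (by linarith)
    have hle : jointDivergence ∞ ((1 / 2 : ℝ) • P + (1 / 2 : ℝ) • P') (meanPM ∞ h0 (h𝒜 _ hR)) ≤ ((C + ε : ℝ) : EReal) := by
      rw [jointDivergence_meanPM]
      exact (hC _ hR).trans (by exact_mod_cast (by linarith : C ≤ C + ε))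
    rw [jointDivergence_top_le_iff (h𝒜 _ hR)] at hle
    refine ⟨_, (jointDivergence_top_le_iff (h𝒜 P hP) _ _).2 fun w hw =>
      hle w (hpos w (Or.inl ((h𝒜 P hP).pos hw))),
      (jointDivergence_top_le_iff (h𝒜 P' hP') _ _).2 fun w hw =>
      hle w (hpos w (Or.inr ((h𝒜 P' hP').pos hw)))⟩
  set K := fdivOf α.toReal
  have hK := strictMono_fdivOf α.toReal
  have hKC : 0 ≤ K C := by
    rw [← fdivOf_zero α.toReal]
    exact hK.monotone hC0
  have hKε : K C < K (C + ε) := hK (by linarith)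
  have hK1 : 0 < K (C + ε) := hKC.trans_lt hKε
  -- The condition says K(C) ≤ (1 - t) K(C + ε), which bounds the almost optimal prior's share
  -- without using δ.
  obtain ⟨t, ht0, ht1, htK⟩ : ∃ t : ℝ, 0 < t ∧ t < 1 ∧ t * K (C + ε) ≤ K (C + ε) - K C := by
    refine ⟨(K (C + ε) - K C) / (2 * K (C + ε)), div_pos (by linarith) (by linarith), ?_, ?_⟩
    · rw [div_lt_one (by linarith)]; linarith
    · rw [div_mul_eq_mul_div, div_le_iff₀ (by linarith)]
      nlinarith [mul_pos hK1 (sub_pos.2 hKε)]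
  -- With t fixed, δ is chosen so that removing the share (1 - t) K(C - δ) from K(C) leaves at most
  -- t K(C + ε) for the other prior. This is possible by continuity since K(C) < K(C + ε).
  obtain ⟨δ, hδ, hδ0⟩ : ∃ δ : ℝ, K C - t * K (C + ε) ≤ (1 - t) * K (C - δ) ∧ 0 < δ := by
    have hcont : Tendsto (fun δ : ℝ => (1 - t) * K (C - δ)) (𝓝[>] 0) (𝓝 ((1 - t) * K (C - 0))) := by
      refine Tendsto.mono_left ?_ nhdsWithin_le_nhds
      have := (continuous_fdivOf α.toReal).comp (continuous_const (y := C).sub continuous_id)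
      exact (this.const_mul (1 - t)).tendsto' 0 _ rfl
    rw [sub_zero] at hcont
    have hlt : K C - t * K (C + ε) < (1 - t) * K C := by
      nlinarith [mul_lt_mul_of_pos_left hKε ht0]
    exact ((hcont.eventually (eventually_ge_nhds hlt)).and self_mem_nhdsWithin).exists
  refine ⟨δ, hδ0, fun P hP P' hP' hI => ?_⟩
  have hR : (1 - t) • P' + t • P ∈ 𝒜 := hconv hP' hP (by linarith) ht0.le (by ring)
  set Q := meanPM α h0 (h𝒜 _ hR)
  set x := ∑ w ∈ P'.support, ENNReal.ofReal (P' w) * fdiv α.toReal (w : Measure Y) (Q : Measure Y)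
    with hx
  set y := ∑ w ∈ P.support, ENNReal.ofReal (P w) * fdiv α.toReal (w : Measure Y) (Q : Measure Y)
    with hy
  have hsum : ENNReal.ofReal (1 - t) * x + ENNReal.ofReal t * y ≤ ENNReal.ofReal (K C) := by
    rw [hx, hy, ← sum_mul_convex_combination (sub_nonneg.2 ht1.le) ht0.le (h𝒜 P' hP') (h𝒜 P hP)]
    refine ((jointDivergence_le_iff h0 ht (h𝒜 _ hR) Q C).1 ?_).2
    rw [jointDivergence_meanPM]
    exact hC _ hR
  -- Near-optimality of P' enters here: its joint divergence relative to any Q is at least its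
  -- information, which exceeds C - δ.
  have hlow : ENNReal.ofReal (K (C - δ)) ≤ x := by
    by_contra! h
    rcases lt_or_ge (C - δ) 0 with hneg | hnn
    · have : K (C - δ) < 0 := by
        rw [← fdivOf_zero α.toReal]
        exact hK hneg
      rw [ENNReal.ofReal_of_nonpos this.le] at h
      exact not_lt_zero h
    · have h1 := (jointDivergence_le_iff h0 ht (h𝒜 P' hP') Q (C - δ)).2 ⟨hnn, h.le⟩
      exact absurd (hI.trans_le ((information_le_jointDivergence h0 (h𝒜 P' hP') Q).trans h1))
        (lt_irrefl _)
  have hxt : x ≠ ∞ := by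
    intro h
    rw [h, ENNReal.mul_top (ENNReal.ofReal_pos.2 (sub_pos.2 ht1)).ne', top_add, top_le_iff] at hsum
    exact ENNReal.ofReal_ne_top hsum
  have hyt : y ≠ ∞ := by
    intro h
    rw [h, ENNReal.mul_top (ENNReal.ofReal_pos.2 ht0).ne', add_top, top_le_iff] at hsum
    exact ENNReal.ofReal_ne_top hsum
  have hx0 : 0 ≤ x.toReal := ENNReal.toReal_nonneg
  have hy0 : 0 ≤ y.toReal := ENNReal.toReal_nonneg
  have hsum' : (1 - t) * x.toReal + t * y.toReal ≤ K C := by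
    rw [← ENNReal.ofReal_toReal hxt, ← ENNReal.ofReal_toReal hyt,
      ← ENNReal.ofReal_mul (sub_nonneg.2 ht1.le), ← ENNReal.ofReal_mul ht0.le,
      ← ENNReal.ofReal_add (mul_nonneg (sub_nonneg.2 ht1.le) hx0) (mul_nonneg ht0.le hy0)] at hsum
    exact (ENNReal.ofReal_le_ofReal_iff hKC).1 hsum
  have hlow' : K (C - δ) ≤ x.toReal := (ENNReal.ofReal_le_iff_le_toReal hxt).1 hlow
  refine ⟨Q, (jointDivergence_le_iff h0 ht (h𝒜 P hP) Q _).2 ⟨by linarith, ?_⟩,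
    (jointDivergence_le_iff h0 ht (h𝒜 P' hP') Q _).2 ⟨by linarith, ?_⟩⟩
  · rw [← hy, ENNReal.le_ofReal_iff_toReal_le hyt hK1.le]
    have h1 : (1 - t) * K (C - δ) ≤ (1 - t) * x.toReal :=
      mul_le_mul_of_nonneg_left hlow' (sub_nonneg.2 ht1.le)
    refine le_of_mul_le_mul_left (a := t) ?_ ht0
    change t * y.toReal ≤ t * K (C + ε)
    linarith
  · rw [← hx, ENNReal.le_ofReal_iff_toReal_le hxt hK1.le]
    refine le_of_mul_le_mul_left (a := 1 - t) ?_ (sub_pos.2 ht1)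
    change (1 - t) * x.toReal ≤ (1 - t) * K (C + ε)
    have := mul_nonneg ht0.le hy0
    linarith

end Mixing

/-! ### Existence of the center, convergence of Rényi means and the van Erven–Harremoës bound. -/

section Center

variable {Y : Type*} [MeasurableSpace Y] {α : ℝ≥0∞} {𝒜 : Set (ProbabilityMeasure Y →₀ ℝ)}

/-- Sibson's identity solved for the divergence of the mean; the information is a real number, so
the subtraction is legitimate. -/
lemma divergence_renyiMean_le (h0 : α ≠ 0) {P : ProbabilityMeasure Y →₀ ℝ} (hP : IsPrior P)
    {r c : ℝ} (hr : information α P = r) {Q : ProbabilityMeasure Y}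
    (h : jointDivergence α P Q ≤ c) :
    divergence α (renyiMean α P) (Q : Measure Y) ≤ ((c - r : ℝ) : EReal) := by
  rwa [jointDivergence_eq hP h0, hr, coe_add_le_coe_iff] at h

/-- Rényi means of an information-maximizing sequence form a Cauchy sequence. -/
lemma cauchy_renyiMean (h0 : α ≠ 0) (h𝒜 : ∀ P ∈ 𝒜, IsPrior P) (hconv : Convex ℝ 𝒜) {C : ℝ}
    (hC0 : 0 ≤ C) (hC : ∀ P ∈ 𝒜, information α P ≤ C) {P : ℕ → (ProbabilityMeasure Y →₀ ℝ)}
    (hP : ∀ n, P n ∈ 𝒜) {r : ℕ → ℝ} (hr : ∀ n, information α (P n) = r n)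
    (hlim : Tendsto r atTop (𝓝 C)) {ε : ℝ} (hε : 0 < ε) :
    ∃ N : ℕ, ∀ m ≥ N, ∀ n ≥ N, tvDist (renyiMean α (P m)) (renyiMean α (P n)) < ε := by
  have hprob : ∀ n, IsProbabilityMeasure (renyiMean α (P n)) := fun n =>
    isProbabilityMeasure_renyiMean (h𝒜 _ (hP n)) h0
  obtain ⟨δ, hδ, htv⟩ := exists_tvDist_le_of_divergence_le (Z := Y) h0 (ε := ε / 4) (by positivity)
  obtain ⟨η, hη, hmix⟩ := exists_mixture_jointDivergence_le h0 h𝒜 hconv hC0 hC (half_pos hδ)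
  -- Distance below η from C lets the mixing lemma apply; distance below δ / 2 turns its bound C + δ
  -- / 2 into a divergence of at most δ between each mean and R.
  obtain ⟨N, hN⟩ := eventually_atTop.1 (hlim.eventually
    (eventually_gt_nhds (show C - min η (δ / 2) < C by linarith [lt_min hη (half_pos hδ)])))
  refine ⟨N, fun m hm n hn => ?_⟩
  have hrm := hN m hm
  have hrn := hN n hn
  have hm1 := min_le_left η (δ / 2)
  have hm2 := min_le_right η (δ / 2)
  obtain ⟨R, hRm, hRn⟩ := hmix (P m) (hP m) (P n) (hP n)
    (by rw [hr n]; exact_mod_cast (by linarith : C - η < r n))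
  have key : ∀ k, C - min η (δ / 2) < r k → jointDivergence α (P k) R ≤ ((C + δ / 2 : ℝ) : EReal) →
      tvDist (renyiMean α (P k)) (R : Measure Y) ≤ ε / 4 := by
    intro k hk hJ
    refine htv _ _ ((divergence_renyiMean_le h0 (h𝒜 _ (hP k)) (hr k) hJ).trans ?_)
    exact_mod_cast (by linarith : C + δ / 2 - r k ≤ δ)
  have h1 := key m hrm hRm
  have h2 := key n hrn hRn
  rw [tvDist_comm] at h2
  linarith [tvDist_triangle (renyiMean α (P m)) (R : Measure Y) (renyiMean α (P n))]

/-- Rényi means of an information-maximizing sequence converge to every probability measure with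
respect to which all joint divergences are at most the capacity. -/
lemma tendsto_renyiMean (h0 : α ≠ 0) (h𝒜 : ∀ P ∈ 𝒜, IsPrior P) {C : ℝ}
    {P : ℕ → (ProbabilityMeasure Y →₀ ℝ)} (hP : ∀ n, P n ∈ 𝒜) {r : ℕ → ℝ}
    (hr : ∀ n, information α (P n) = r n) (hlim : Tendsto r atTop (𝓝 C))
    {q : ProbabilityMeasure Y} (hq : ∀ P ∈ 𝒜, jointDivergence α P q ≤ C) :
    Tendsto (fun n => tvDist (renyiMean α (P n)) (q : Measure Y)) atTop (𝓝 0) := by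
  have hprob : ∀ n, IsProbabilityMeasure (renyiMean α (P n)) := fun n =>
    isProbabilityMeasure_renyiMean (h𝒜 _ (hP n)) h0
  rw [Metric.tendsto_atTop]
  intro ε hε
  obtain ⟨δ, hδ, htv⟩ := exists_tvDist_le_of_divergence_le (Z := Y) h0 (ε := ε / 2) (by positivity)
  obtain ⟨N, hN⟩ := eventually_atTop.1 (hlim.eventually
    (eventually_gt_nhds (show C - δ < C by linarith)))
  refine ⟨N, fun n hn => ?_⟩
  rw [Real.dist_eq, sub_zero, abs_of_nonneg tvDist_nonneg]
  refine (htv _ _ ((divergence_renyiMean_le h0 (h𝒜 _ (hP n)) (hr n) (hq _ (hP n))).trans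
    ?_)).trans_lt (by linarith)
  exact_mod_cast (by linarith [hN n hn] : C - r n ≤ δ)

/-- The limit of the Rényi means of an information-maximizing sequence bounds all joint divergences
by the capacity. -/
lemma exists_jointDivergence_le (h0 : α ≠ 0) (h𝒜 : ∀ P ∈ 𝒜, IsPrior P) (hconv : Convex ℝ 𝒜)
    {C : ℝ} (hC0 : 0 ≤ C) (hC : ∀ P ∈ 𝒜, information α P ≤ C)
    {P : ℕ → (ProbabilityMeasure Y →₀ ℝ)} (hP : ∀ n, P n ∈ 𝒜) {r : ℕ → ℝ}
    (hr : ∀ n, information α (P n) = r n) (hlim : Tendsto r atTop (𝓝 C)) :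
    ∃ q : ProbabilityMeasure Y, ∀ P ∈ 𝒜, jointDivergence α P q ≤ C := by
  have hprob : ∀ n, IsProbabilityMeasure (renyiMean α (P n)) := fun n =>
    isProbabilityMeasure_renyiMean (h𝒜 _ (hP n)) h0
  obtain ⟨q, hq⟩ := exists_tendsto_tvDist_of_cauchy (fun n => renyiMean α (P n)) fun ε hε =>
    cauchy_renyiMean h0 h𝒜 hconv hC0 hC hP hr hlim hε
  refine ⟨q, fun P' hP' => ?_⟩
  have hprob' := isProbabilityMeasure_renyiMean (h𝒜 _ hP') h0
  obtain ⟨s, hs⟩ := exists_information_eq_coe (h𝒜 _ hP') h0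
  -- R is the mixing measure for P' and a late P n. It is close to q because the mean of P n is
  -- close to both R and q.
  have hstep : ∀ ε : ℝ, 0 < ε → ∃ R : ProbabilityMeasure Y,
      jointDivergence α P' R ≤ ((C + ε : ℝ) : EReal) ∧ tvDist (R : Measure Y) q ≤ ε := by
    intro ε hε
    obtain ⟨δ, hδ, htv⟩ := exists_tvDist_le_of_divergence_le (Z := Y) h0 (ε := ε / 2)
      (by positivity)
    have hm0 : 0 < min ε (δ / 2) := lt_min hε (half_pos hδ)
    have hm1 := min_le_left ε (δ / 2)
    have hm2 := min_le_right ε (δ / 2)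
    obtain ⟨η, hη, hmix⟩ := exists_mixture_jointDivergence_le h0 h𝒜 hconv hC0 hC hm0
    obtain ⟨n, hn1, hn2⟩ := ((hlim.eventually (eventually_gt_nhds
      (show C - min η (δ / 2) < C by linarith [lt_min hη (half_pos hδ)]))).and
      (hq.eventually (eventually_lt_nhds (half_pos hε)))).exists
    have hm3 := min_le_left η (δ / 2)
    have hm4 := min_le_right η (δ / 2)
    obtain ⟨R, hR1, hR2⟩ := hmix P' hP' (P n) (hP n)
      (by rw [hr n]; exact_mod_cast (by linarith : C - η < r n))
    refine ⟨R, hR1.trans (by exact_mod_cast (by linarith)), ?_⟩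
    have h1 : tvDist (renyiMean α (P n)) (R : Measure Y) ≤ ε / 2 := by
      refine htv _ _ ((divergence_renyiMean_le h0 (h𝒜 _ (hP n)) (hr n) hR2).trans ?_)
      exact_mod_cast (by linarith : C + min ε (δ / 2) - r n ≤ δ)
    rw [tvDist_comm] at h1
    linarith [tvDist_triangle (R : Measure Y) (renyiMean α (P n)) (q : Measure Y)]
  choose R hR1 hR2 using fun k : ℕ => hstep (1 / ((k : ℝ) + 1)) Nat.one_div_pos_of_nat
  have hzero := tendsto_one_div_add_atTop_nhds_zero_nat (𝕜 := ℝ)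
  -- By Sibson's identity only the divergence of the fixed mean of P' from R k has to pass to the
  -- limit.
  rw [jointDivergence_eq (h𝒜 _ hP') h0, hs, coe_add_le_coe_iff]
  refine divergence_le_of_tendsto h0 (V := fun _ => renyiMean α P')
    (R := fun k => (R k : Measure Y)) (c := fun k : ℕ => C + 1 / ((k : ℝ) + 1) - s) ?_
    (squeeze_zero (fun k => tvDist_nonneg) hR2 hzero) ?_ fun k =>
      divergence_renyiMean_le h0 (h𝒜 _ hP') hs (hR1 k)
  · simp only [tvDist_self]
    exact tendsto_const_nhds
  · simpa using (hzero.const_add C).sub_const s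

/-- The van Erven–Harremoës bound for a limit of Rényi means. -/
lemma coe_add_divergence_le (h0 : α ≠ 0) (h𝒜 : ∀ P ∈ 𝒜, IsPrior P) {C : ℝ}
    {P : ℕ → (ProbabilityMeasure Y →₀ ℝ)} (hP : ∀ n, P n ∈ 𝒜) {r : ℕ → ℝ}
    (hr : ∀ n, information α (P n) = r n) (hlim : Tendsto r atTop (𝓝 C))
    {q : ProbabilityMeasure Y}
    (hq : Tendsto (fun n => tvDist (renyiMean α (P n)) (q : Measure Y)) atTop (𝓝 0))
    (Q : ProbabilityMeasure Y) :
    (C : EReal) + divergence α (q : Measure Y) (Q : Measure Y)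
      ≤ ⨆ P ∈ 𝒜, jointDivergence α P Q := by
  have hprob : ∀ n, IsProbabilityMeasure (renyiMean α (P n)) := fun n =>
    isProbabilityMeasure_renyiMean (h𝒜 _ (hP n)) h0
  have hle : ∀ n, jointDivergence α (P n) Q ≤ ⨆ P ∈ 𝒜, jointDivergence α P Q := fun n =>
    le_iSup₂ (f := fun P (_ : P ∈ 𝒜) => jointDivergence α P Q) (P n) (hP n)
  have hnn := (jointDivergence_nonneg h0 (h𝒜 _ (hP 0)) Q).trans (hle 0)
  generalize (⨆ P ∈ 𝒜, jointDivergence α P Q) = S at *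
  -- For infinite S there is nothing to prove; S = ⊥ is excluded by nonnegativity, which uses a
  -- member of 𝒜.
  induction S with
  | bot => simp at hnn
  | top => exact le_top
  | coe S =>
    rw [coe_add_le_coe_iff]
    refine divergence_le_of_tendsto h0 (V := fun n => renyiMean α (P n))
      (R := fun _ => (Q : Measure Y)) hq ?_ (hlim.const_sub S) fun n =>
        divergence_renyiMean_le h0 (h𝒜 _ (hP n)) (hr n) (hle n)
    simp only [tvDist_self]
    exact tendsto_const_nhds

lemma iInf_jointDivergence (h0 : α ≠ 0) {P : ProbabilityMeasure Y →₀ ℝ} (hP : IsPrior P) :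
    ⨅ Q : ProbabilityMeasure Y, jointDivergence α P Q = information α P :=
  le_antisymm ((iInf_le _ (meanPM α h0 hP)).trans_eq (jointDivergence_meanPM h0 hP))
    (le_iInf fun Q => information_le_jointDivergence h0 hP Q)

lemma information_le_capacity {P : ProbabilityMeasure Y →₀ ℝ} (hP : P ∈ 𝒜) :
    information α P ≤ capacity α 𝒜 :=
  le_iSup₂ (f := fun P (_ : P ∈ 𝒜) => information α P) P hP

/-- Only the upper bound carries content, since information never exceeds joint divergence. -/
lemma isCenter_iff (h0 : α ≠ 0) (h𝒜 : ∀ P ∈ 𝒜, IsPrior P) {q : ProbabilityMeasure Y} :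
    IsCenter α 𝒜 q ↔ ∀ P ∈ 𝒜, jointDivergence α P q ≤ capacity α 𝒜 := by
  constructor
  · intro h P hP
    rw [IsCenter] at h
    rw [h]
    exact le_iSup₂ (f := fun P (_ : P ∈ 𝒜) => jointDivergence α P q) P hP
  · intro h
    exact le_antisymm (iSup₂_mono fun P hP => information_le_jointDivergence h0 (h𝒜 P hP) q)
      (iSup₂_le h)

/-- A finite capacity is a nonnegative real number that is approached by a sequence of priors. -/
lemma exists_maximizing_sequence (h0 : α ≠ 0) (h𝒜 : ∀ P ∈ 𝒜, IsPrior P) (hne : 𝒜.Nonempty)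
    (hfin : capacity α 𝒜 < ⊤) :
    ∃ C : ℝ, 0 ≤ C ∧ capacity α 𝒜 = C ∧ ∃ (P : ℕ → (ProbabilityMeasure Y →₀ ℝ)) (r : ℕ → ℝ),
      (∀ n, P n ∈ 𝒜) ∧ (∀ n, information α (P n) = r n) ∧ Tendsto r atTop (𝓝 C) := by
  obtain ⟨P₀, hP₀⟩ := hne
  have hnn : 0 ≤ capacity α 𝒜 :=
    (information_nonneg h0 (h𝒜 _ hP₀)).trans (information_le_capacity hP₀)
  obtain ⟨C, hC⟩ : ∃ C : ℝ, capacity α 𝒜 = C := by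
    generalize capacity α 𝒜 = c at *
    induction c with
    | bot => simp at hnn
    | top => simp at hfin
    | coe c => exact ⟨c, rfl⟩
  refine ⟨C, by rw [hC] at hnn; exact_mod_cast hnn, hC, ?_⟩
  have hex : ∀ n : ℕ, ∃ P ∈ 𝒜, ((C - 1 / ((n : ℝ) + 1) : ℝ) : EReal) < information α P := by
    intro n
    have hpos : (0 : ℝ) < 1 / ((n : ℝ) + 1) := Nat.one_div_pos_of_nat
    have hlt : ((C - 1 / ((n : ℝ) + 1) : ℝ) : EReal) < capacity α 𝒜 := by
      rw [hC]
      exact_mod_cast (by linarith : C - 1 / ((n : ℝ) + 1) < C)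
    obtain ⟨P, hP⟩ := lt_iSup_iff.1 hlt
    obtain ⟨hP1, hP2⟩ := lt_iSup_iff.1 hP
    exact ⟨P, hP1, hP2⟩
  choose P hP hPlt using hex
  choose r hr using fun n => exists_information_eq_coe (h𝒜 _ (hP n)) h0
  refine ⟨P, r, hP, hr, ?_⟩
  have hzero := tendsto_one_div_add_atTop_nhds_zero_nat (𝕜 := ℝ)
  refine tendsto_of_tendsto_of_tendsto_of_le_of_le (g := fun n : ℕ => C - 1 / ((n : ℝ) + 1))
    (by simpa using hzero.const_sub C) tendsto_const_nhds (fun n => ?_) fun n => ?_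
  · have := hPlt n
    rw [hr n] at this
    exact_mod_cast this.le
  · have := information_le_capacity (α := α) (hP n)
    rw [hr n, hC] at this
    exact_mod_cast this

end Center

end Renyi

/-! ### The minimax identity, the center and its properties. -/

theorem mainTheorem6 {Y : Type*} [MeasurableSpace Y] (α : ℝ≥0∞) (hα : 0 < α)
    (𝒲 : Set (ProbabilityMeasure Y)) (𝒜 : Set (ProbabilityMeasure Y →₀ ℝ))
    (h𝒜 : 𝒜 ⊆ Renyi.priors 𝒲) (hconv : Convex ℝ 𝒜) (hne : 𝒜.Nonempty) :
    Renyi.capacity α 𝒜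
        = ⨆ P ∈ 𝒜, ⨅ Q : ProbabilityMeasure Y, Renyi.jointDivergence α P Q ∧
    Renyi.capacity α 𝒜
        = ⨅ Q : ProbabilityMeasure Y, ⨆ P ∈ 𝒜, Renyi.jointDivergence α P Q ∧
    (Renyi.capacity α 𝒜 < ⊤ →
      (∃! q : ProbabilityMeasure Y, Renyi.IsCenter α 𝒜 q) ∧
      ∀ q : ProbabilityMeasure Y, Renyi.IsCenter α 𝒜 q →
        (∀ P : ℕ → (ProbabilityMeasure Y →₀ ℝ), (∀ n, P n ∈ 𝒜) →
          Tendsto (fun n => Renyi.information α (P n)) atTop (𝓝 (Renyi.capacity α 𝒜)) →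
          (∀ ε : ℝ, 0 < ε → ∃ N : ℕ, ∀ m ≥ N, ∀ n ≥ N,
            Renyi.tvDist (Renyi.renyiMean α (P m)) (Renyi.renyiMean α (P n)) < ε) ∧
          (∀ Q : ProbabilityMeasure Y,
            Tendsto (fun n => Renyi.tvDist (Renyi.renyiMean α (P n)) (Q : Measure Y))
              atTop (𝓝 0) ↔ Q = q)) ∧
        (∀ Q : ProbabilityMeasure Y,
          Renyi.capacity α 𝒜 + Renyi.divergence α (q : Measure Y) (Q : Measure Y)
            ≤ ⨆ P ∈ 𝒜, Renyi.jointDivergence α P Q)) := by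
  have h0 : α ≠ 0 := hα.ne'
  have hprior : ∀ P ∈ 𝒜, Renyi.IsPrior P := fun P hP => Renyi.isPrior_of_mem_priors (h𝒜 hP)
  have hcenter : Renyi.capacity α 𝒜 < ⊤ →
      ∃ q : ProbabilityMeasure Y, Renyi.IsCenter α 𝒜 q := by
    intro hfin
    obtain ⟨C, hC0, hC, P, r, hP, hr, hlim⟩ :=
      Renyi.exists_maximizing_sequence h0 hprior hne hfin
    obtain ⟨q, hq⟩ := Renyi.exists_jointDivergence_le h0 hprior hconv hC0
      (fun P hP => hC ▸ Renyi.information_le_capacity hP) hP hr hlim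
    exact ⟨q, (Renyi.isCenter_iff h0 hprior).2 fun P hP => hC ▸ hq P hP⟩
  refine ⟨?_, le_antisymm ?_ ?_, fun hfin => ?_⟩
  · exact iSup_congr fun P => iSup_congr fun hP => (Renyi.iInf_jointDivergence h0 (hprior P hP)).symm
  · exact le_iInf fun Q => iSup₂_mono fun P hP =>
      Renyi.information_le_jointDivergence h0 (hprior P hP) Q
  · rcases eq_or_ne (Renyi.capacity α 𝒜) ⊤ with h | h
    · rw [h]
      exact le_top
    -- When the capacity is finite, the center itself witnesses the nontrivial half of the minimax
    -- identity.
    · obtain ⟨q, hq⟩ := hcenter (lt_top_iff_ne_top.2 h)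
      exact (iInf_le _ q).trans (le_of_eq (Eq.symm hq))
  · obtain ⟨q, hq⟩ := hcenter hfin
    obtain ⟨C, hC0, hC, P, r, hP, hr, hlim⟩ :=
      Renyi.exists_maximizing_sequence h0 hprior hne hfin
    have hle : ∀ P ∈ 𝒜, Renyi.information α P ≤ C := fun P hP =>
      hC ▸ Renyi.information_le_capacity hP
    have hconvg : ∀ {P : ℕ → (ProbabilityMeasure Y →₀ ℝ)} {r : ℕ → ℝ}, (∀ n, P n ∈ 𝒜) →
        (∀ n, Renyi.information α (P n) = r n) → Tendsto r atTop (𝓝 C) →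
        ∀ q : ProbabilityMeasure Y, Renyi.IsCenter α 𝒜 q →
        Tendsto (fun n => Renyi.tvDist (Renyi.renyiMean α (P n)) (q : Measure Y)) atTop (𝓝 0) :=
      fun hP hr hlim q hq => Renyi.tendsto_renyiMean h0 hprior hP hr hlim fun P hP =>
        hC ▸ (Renyi.isCenter_iff h0 hprior).1 hq P hP
    have heq : ∀ {P : ℕ → (ProbabilityMeasure Y →₀ ℝ)}, (∀ n, P n ∈ 𝒜) →
        ∀ {q₁ q₂ : ProbabilityMeasure Y},
        Tendsto (fun n => Renyi.tvDist (Renyi.renyiMean α (P n)) (q₁ : Measure Y)) atTop (𝓝 0) →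
        Tendsto (fun n => Renyi.tvDist (Renyi.renyiMean α (P n)) (q₂ : Measure Y)) atTop (𝓝 0) →
        q₁ = q₂ := by
      intro P hP q₁ q₂ h₁ h₂
      have := fun n => Renyi.isProbabilityMeasure_renyiMean (hprior _ (hP n)) h0
      have h := Renyi.eq_of_tendsto_tvDist (μ := (q₁ : Measure Y)) (ν := (q₂ : Measure Y)) h₁ h₂
      exact Subtype.ext h
    -- Two centers are both limits of the Rényi means of the same maximizing sequence, hence equal.
    refine ⟨⟨q, hq, fun q' hq' => heq hP (hconvg hP hr hlim q' hq') (hconvg hP hr hlim q hq)⟩,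
      fun q hq => ⟨fun P hP hI => ?_, fun Q => ?_⟩⟩
    · choose r hr using fun n => Renyi.exists_information_eq_coe (hprior _ (hP n)) h0
      have hlim : Tendsto r atTop (𝓝 C) := by
        rw [hC] at hI
        simp_rw [hr] at hI
        exact EReal.tendsto_coe.1 hI
      refine ⟨fun ε hε => Renyi.cauchy_renyiMean h0 hprior hconv hC0 hle hP hr hlim hε,
        fun Q => ⟨fun hQ => heq hP hQ (hconvg hP hr hlim q hq), ?_⟩⟩
      rintro rfl
      exact hconvg hP hr hlim Q hq
    · rw [hC]
      exact Renyi.coe_add_divergence_le h0 hprior hP hr hlim (hconvg hP hr hlim q hq) Q
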